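/- Let $k$ be a commutative ring containing $\mathbb{Q}$. For a $\mathbb{Z}$-graded $k$-module $W$ let $S(W)$ be the graded symmetric algebra (the tensor algebra modulo $a\otimes b=(-1)^{|a||b|}b\otimes a$ for homogeneous $a,b$) with its linear grading and its shuffle coproduct $\Delta$, for which $\Delta(1)=1\otimes 1$ and $\Delta(w)=w\otimes 1+1\otimes w$ for $w\in W$. A vector field of degree $1$ on $W$ is a coderivation $Q$ of degree $1$ of $(S(W),\Delta)$; its Taylor coefficients are the maps $Q_n:W^{\odot n}\to S(W)\to W$, $n\ge 0$, and they determine it. A formal DG manifold $(W,Q^W)$ is a graded module $W$ with a vector field $Q^W$ of degree $1$ such that $Q^W\circ Q^W=0$ (one says that $Q^W$ is a DG structure on $W$); a morphism $(V,Q^V)\to(W,Q^W)$ is a coalgebra map $S(V)\to S(W)$ of degree $0$ with $1\mapsto 1$ that commutes with $Q^V$ and $Q^W$. It is local if $Q^W_0=0$. A vector field on a factor of a product $B\times M$ is regarded as a vector field on $B\times M$ by evaluating its Taylor coefficients on the components in that factor. Let $(M,Q^M)$ be a formal DG manifold and $(B,Q^B)$ a local formal DG manifold. A deformation $(B,Q^B,Q)$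 of $M$ with base $B$ is a vector field $Q$ of degree $1$ on $B\times M$ with $Q_0=0$ and $Q|_{\{0\}\times M}=0$, such that $\tilde Q:=Q^B+Q^M+Q$ is a DG structure on $B\times M$ and the projection $(B\times M,\tilde Q)\to(B,Q^B)$ is a morphism of formal DG manifolds. It is trivial if the projection $B\times M\to M$ respects $\tilde Q$ and $Q^M$; the trivial deformation with base $B$ is the one with $Q=0$. A morphism of deformations $(B,Q^B,Q)\to(B',Q^{B'},Q')$ of $M$ is a pair $(F,f)$ of morphisms of formal DG manifolds $F:(B\times M,\tilde Q)\to(B'\times M,\tilde Q')$ and $f:(B,Q^B)\to(B',Q^{B'})$ such that $F$, $f$ and the projections to $B$ and $B'$ form a cartesian square of formal DG manifolds and $F$ is compatible with the inclusions of $M=\{0\}\times M$. Let $(B,Q^B,Q)$ be a deformation of $M$ such that $Q_1=0$ and the complex $(B,Q^B_1)$ is contractible, i.e. there is a $k$-linear map $h:B\to B$ of degree $-1$ with $Q^B_1h+hQ^B_1=\operatorname{id}_B$. Then $(B,Q^B,0)$ is a deformation of $M$, it is trivial, and $(B,Q^B,Q)$ is isomorphic to it as a deformation of $M$, by an isomorphism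 $(F,f)$ with $f=\operatorname{id}_B$. -/

import Mathlib

open scoped TensorProduct DirectSum
open CategoryTheory

universe u v

noncomputable section

namespace FormalDG

variable (k : Type v) [CommRing k]

/-! ### Graded modules -/

/-- A `ℤ`-graded `k`-module (a formal supermanifold is such a module, pointed by zero). -/
structure GrMod where
  carrier : Type u
  [addCommGroup : AddCommGroup carrier]
  [module : Module k carrier]
  gr : ℤ → Submodule k carrier
  [decomp : DirectSum.Decomposition gr]

variable {k}

namespace GrMod

instance : CoeSort (GrMod.{u} k) (Type u) := ⟨GrMod.carrier⟩

attribute [instance] GrMod.addCommGroup GrMod.module GrMod.decomp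

/-- The product `V × W`, graded by `(V × W)^i = V^i × W^i`. -/
def prod (V W : GrMod.{u} k) : GrMod.{u} k where
  carrier := V × W
  gr i := (V.gr i).prod (W.gr i)
  decomp := DirectSum.Decomposition.ofLinearMap _
    (((DirectSum.lmap fun i => (LinearMap.inl k V W).restrict
          (p := V.gr i) (q := (V.gr i).prod (W.gr i))
          fun x hx => ⟨hx, (W.gr i).zero_mem⟩) ∘ₗ
        (DirectSum.decomposeLinearEquiv V.gr).toLinearMap).coprod
      ((DirectSum.lmap fun i => (LinearMap.inr k V W).restrict
          (p := W.gr i) (q := (V.gr i).prod (W.gr i))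
          fun x hx => ⟨(V.gr i).zero_mem, hx⟩) ∘ₗ
        (DirectSum.decomposeLinearEquiv W.gr).toLinearMap))
    (by
      apply LinearMap.prod_ext
      · refine DirectSum.decompose_lhom_ext V.gr fun i => LinearMap.ext fun x => ?_
        simp [DirectSum.lmap_lof]
        rfl
      · refine DirectSum.decompose_lhom_ext W.gr fun i => LinearMap.ext fun x => ?_
        simp [DirectSum.lmap_lof]
        rfl)
    (by
      refine DirectSum.linearMap_ext k fun i => LinearMap.ext fun x => ?_
      obtain ⟨⟨a, b⟩, ha, hb⟩ := x
      simp only [LinearMap.comp_apply, DirectSum.coeLinearMap_lof, LinearMap.coprod_apply,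
        LinearEquiv.coe_coe, DirectSum.decomposeLinearEquiv_apply, LinearMap.id_apply]
      rw [DirectSum.decompose_of_mem _ ha, DirectSum.decompose_of_mem _ hb,
        ← DirectSum.lof_eq_of k, ← DirectSum.lof_eq_of k, DirectSum.lmap_lof,
        DirectSum.lmap_lof, ← map_add]
      congr 1
      refine Subtype.ext ?_
      change (a, (0 : W)) + ((0 : V), b) = (a, b)
      simp)

/-- The linear map `x ↦ (-1)^{j|x|} x` of a graded module. -/
def koszul {A : Type*} [AddCommGroup A] [Module k A] (𝒜 : ℤ → Submodule k A)
    [DirectSum.Decomposition 𝒜] (j : ℤ) : A →ₗ[k] A :=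
  DirectSum.toModule k ℤ A (fun i => ((-1 : ℤˣ) ^ (j * i)) • (𝒜 i).subtype) ∘ₗ
    (DirectSum.decomposeLinearEquiv 𝒜).toLinearMap

theorem koszul_of_mem {A : Type*} [AddCommGroup A] [Module k A] (𝒜 : ℤ → Submodule k A)
    [DirectSum.Decomposition 𝒜] (j : ℤ) {i : ℤ} {x : A} (hx : x ∈ 𝒜 i) :
    koszul 𝒜 j x = ((-1 : ℤˣ) ^ (j * i)) • x := by
  simp only [koszul, LinearMap.comp_apply, LinearEquiv.coe_coe,
    DirectSum.decomposeLinearEquiv_apply]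
  rw [DirectSum.decompose_of_mem _ hx, ← DirectSum.lof_eq_of k, DirectSum.toModule_lof]
  rfl

/-- A linear map of degree `j`. -/
def HasDegree {A B : Type*} [AddCommGroup A] [Module k A] [AddCommGroup B] [Module k B]
    (𝒜 : ℤ → Submodule k A) (ℬ : ℤ → Submodule k B) (j : ℤ) (f : A →ₗ[k] B) : Prop :=
  ∀ i, ∀ x ∈ 𝒜 i, f x ∈ ℬ (i + j)

theorem hasDegree_inl (V W : GrMod.{u} k) :
    HasDegree V.gr (V.prod W).gr 0 (LinearMap.inl k V W) :=
  fun i x hx => by rw [add_zero]; exact ⟨hx, (W.gr i).zero_mem⟩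

theorem hasDegree_inr (V W : GrMod.{u} k) :
    HasDegree W.gr (V.prod W).gr 0 (LinearMap.inr k V W) :=
  fun i x hx => by rw [add_zero]; exact ⟨(V.gr i).zero_mem, hx⟩

theorem hasDegree_fst (V W : GrMod.{u} k) :
    HasDegree (V.prod W).gr V.gr 0 (LinearMap.fst k V W) :=
  fun i x hx => by rw [add_zero]; exact hx.1

theorem hasDegree_snd (V W : GrMod.{u} k) :
    HasDegree (V.prod W).gr W.gr 0 (LinearMap.snd k V W) :=
  fun i x hx => by rw [add_zero]; exact hx.2

end GrMod

/-! ### The graded symmetric algebra -/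

/-- The relations `a ⊗ b = (-1)^{|a||b|} b ⊗ a` on the tensor algebra. -/
inductive SymRel (W : GrMod.{u} k) : TensorAlgebra k W → TensorAlgebra k W → Prop
  | swap {i j : ℤ} {a b : W} (ha : a ∈ W.gr i) (hb : b ∈ W.gr j) :
      SymRel W (TensorAlgebra.ι k a * TensorAlgebra.ι k b)
        (((-1 : ℤˣ) ^ (i * j)) • (TensorAlgebra.ι k b * TensorAlgebra.ι k a))

/-- The graded symmetric algebra `S(W)`. -/
def Sym (W : GrMod.{u} k) : Type (max u v) := RingQuot (SymRel W)

namespace Sym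

instance (W : GrMod.{u} k) : Ring (Sym W) := inferInstanceAs (Ring (RingQuot (SymRel W)))

instance (W : GrMod.{u} k) : Algebra k (Sym W) :=
  inferInstanceAs (Algebra k (RingQuot (SymRel W)))

variable (W : GrMod.{u} k)

/-- The inclusion `W → S(W)`. -/
def ι : W →ₗ[k] Sym W :=
  (RingQuot.mkAlgHom k (SymRel W)).toLinearMap ∘ₗ TensorAlgebra.ι k

variable {W}

theorem ι_mul_ι {i j : ℤ} {a b : W} (ha : a ∈ W.gr i) (hb : b ∈ W.gr j) :
    ι W a * ι W b = ((-1 : ℤˣ) ^ (i * j)) • (ι W b * ι W a) := by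
  have h := RingQuot.mkAlgHom_rel k (SymRel.swap ha hb)
  rw [map_mul, AlgHom.map_smul_of_tower, map_mul] at h
  exact h

/-- The universal property of `S(W)`. -/
def lift {A : Type*} [Ring A] [Algebra k A] (f : W →ₗ[k] A)
    (hf : ∀ ⦃i j : ℤ⦄ ⦃a b : W⦄, a ∈ W.gr i → b ∈ W.gr j →
      f a * f b = ((-1 : ℤˣ) ^ (i * j)) • (f b * f a)) : Sym W →ₐ[k] A :=
  RingQuot.liftAlgHom k ⟨TensorAlgebra.lift k f, by
    rintro _ _ ⟨ha, hb⟩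
    rw [map_mul, AlgHom.map_smul_of_tower, map_mul]
    simpa using hf ha hb⟩

@[simp]
theorem lift_ι {A : Type*} [Ring A] [Algebra k A] (f : W →ₗ[k] A)
    (hf : ∀ ⦃i j : ℤ⦄ ⦃a b : W⦄, a ∈ W.gr i → b ∈ W.gr j →
      f a * f b = ((-1 : ℤˣ) ^ (i * j)) • (f b * f a)) (w : W) :
    lift f hf (ι W w) = f w := by
  exact (RingQuot.liftAlgHom_mkAlgHom_apply k _ _ _).trans (TensorAlgebra.lift_ι_apply _ _)

theorem algHom_ext {A : Type*} [Ring A] [Algebra k A] {f g : Sym W →ₐ[k] A}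
    (h : ∀ w, f (ι W w) = g (ι W w)) : f = g :=
  RingQuot.ringQuot_ext' k _ _ (TensorAlgebra.hom_ext (LinearMap.ext h))

/-- The linear graduation of `S(W)`: degree `d` is spanned by the products `w₁ ⊙ ⋯ ⊙ wₙ` of
homogeneous elements with `|w₁| + ⋯ + |wₙ| = d`. -/
def gr (W : GrMod.{u} k) (d : ℤ) : Submodule k (Sym W) :=
  Submodule.span k {x | ∃ l : List (Σ i : ℤ, W.gr i),
    (l.map Sigma.fst).sum = d ∧ (l.map fun a => ι W (a.2 : W)).prod = x}

theorem ι_mem_gr {i : ℤ} {w : W} (hw : w ∈ W.gr i) : ι W w ∈ gr W i :=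
  Submodule.subset_span ⟨[⟨i, w, hw⟩], by simp, by simp⟩

instance : SetLike.GradedMonoid (gr W) where
  one_mem := Submodule.subset_span ⟨[], by simp, by simp⟩
  mul_mem i j x y hx hy := by
    have h := Submodule.mul_mem_mul hx hy
    rw [gr, gr, Submodule.span_mul_span] at h
    refine Submodule.span_mono ?_ h
    rintro _ ⟨_, ⟨l, hl, rfl⟩, _, ⟨m, hm, rfl⟩, rfl⟩
    exact ⟨l ++ m, by simp [hl, hm], by simp⟩

/-- The map `W → ⨁ S(W)_d` (auxiliary). -/
def toGr (W : GrMod.{u} k) : W →ₗ[k] ⨁ d, gr W d :=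
  (DirectSum.lmap fun _ => (ι W).restrict fun _ hx => ι_mem_gr hx) ∘ₗ
    (DirectSum.decomposeLinearEquiv W.gr).toLinearMap

theorem toGr_of_mem {i : ℤ} {w : W} (hw : w ∈ W.gr i) :
    toGr W w = DirectSum.of (fun d => gr W d) i ⟨ι W w, ι_mem_gr hw⟩ := by
  simp only [toGr, LinearMap.comp_apply, LinearEquiv.coe_coe,
    DirectSum.decomposeLinearEquiv_apply]
  rw [DirectSum.decompose_of_mem _ hw, ← DirectSum.lof_eq_of k, ← DirectSum.lof_eq_of k,
    DirectSum.lmap_lof]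
  rfl

theorem toGr_mul_toGr ⦃i j : ℤ⦄ ⦃a b : W⦄ (ha : a ∈ W.gr i) (hb : b ∈ W.gr j) :
    toGr W a * toGr W b = ((-1 : ℤˣ) ^ (i * j)) • (toGr W b * toGr W a) := by
  rw [toGr_of_mem ha, toGr_of_mem hb, DirectSum.of_mul_of, DirectSum.of_mul_of]
  have h : ∀ (s : ℤˣ) (d : ℤ) (y : gr W d),
      s • DirectSum.of (fun d => gr W d) d y = DirectSum.of (fun d => gr W d) d (s • y) := by
    intro s d y
    rw [Units.smul_def, Units.smul_def, map_zsmul]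
  rw [h]
  refine DirectSum.of_eq_of_gradedMonoid_eq (Sigma.subtype_ext (add_comm i j) ?_)
  exact ι_mul_ι ha hb

/-- The decomposition map `S(W) → ⨁ S(W)_d` (auxiliary). -/
def toGrAlg (W : GrMod.{u} k) : Sym W →ₐ[k] ⨁ d, gr W d :=
  RingQuot.liftAlgHom k ⟨TensorAlgebra.lift k (toGr W), by
    rintro _ _ ⟨ha, hb⟩
    rw [map_mul, Units.smul_def, map_zsmul, map_mul, TensorAlgebra.lift_ι_apply,
      TensorAlgebra.lift_ι_apply]
    exact toGr_mul_toGr ha hb⟩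

theorem toGrAlg_ι (w : W) : toGrAlg W (ι W w) = toGr W w :=
  (RingQuot.liftAlgHom_mkAlgHom_apply k _ _ _).trans (TensorAlgebra.lift_ι_apply _ _)

instance : GradedAlgebra (gr W) :=
  GradedAlgebra.ofAlgHom (gr W) (toGrAlg W)
    (by
      refine algHom_ext fun w => ?_
      simp only [AlgHom.comp_apply, toGrAlg_ι, AlgHom.id_apply]
      have h : (DirectSum.coeAlgHom (gr W)).toLinearMap ∘ₗ toGr W = ι W := by
        refine DirectSum.decompose_lhom_ext W.gr fun i => LinearMap.ext fun x => ?_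
        simp only [LinearMap.comp_apply, Submodule.subtype_apply]
        rw [toGr_of_mem x.2]
        simp
      exact LinearMap.congr_fun h w)
    (by
      rintro d ⟨x, hx⟩
      dsimp only
      induction hx using Submodule.span_induction with
      | mem x hx =>
        obtain ⟨l, rfl, rfl⟩ := hx
        induction l with
        | nil =>
          simp only [List.map_nil, List.prod_nil, map_one]
          rfl
        | cons a l ih =>
          simp only [List.map_cons, List.prod_cons, map_mul, toGrAlg_ι]
          rw [ih, toGr_of_mem a.2.2, DirectSum.of_mul_of]
          rfl
      | zero =>
        rw [map_zero]
        exact (map_zero (DirectSum.of (fun d => gr W d) d)).symm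
      | add x y hx hy ihx ihy =>
        rw [map_add, ihx, ihy, ← map_add]
        rfl
      | smul c x hx ih =>
        rw [map_smul, ih, ← DirectSum.lof_eq_of k, ← DirectSum.lof_eq_of k, ← map_smul]
        rfl)

variable (W) in
/-- The projection `S(W) → W` onto the part of polynomial degree one. It is induced by the
algebra map `S(W) → k ⊕ W`, `w ↦ w`, to the square-zero extension. -/
def pr : Sym W →ₗ[k] W :=
  letI : Module kᵐᵒᵖ W := Module.compHom _ ((RingHom.id k).fromOpposite mul_comm)
  haveI : IsCentralScalar k W := ⟨fun _ _ => rfl⟩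
  (TrivSqZeroExt.sndHom k W) ∘ₗ
    (lift (TrivSqZeroExt.inrHom k W) (by intros; simp)).toLinearMap

@[simp]
theorem pr_ι (w : W) : pr W (ι W w) = w := by
  simp [pr]

@[simp]
theorem pr_one : pr W 1 = 0 := by
  let _ : Module kᵐᵒᵖ W := Module.compHom _ ((RingHom.id k).fromOpposite mul_comm)
  have _ : IsCentralScalar k W := ⟨fun _ _ => rfl⟩
  exact congrArg TrivSqZeroExt.snd
    (map_one (lift (W := W) (TrivSqZeroExt.inrHom k W) (by intros; simp)))

theorem pr_ι_mul_ι_mul (a b : W) (x : Sym W) : pr W (ι W a * ι W b * x) = 0 := by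
  simp [pr]

/-! ### The coalgebra structure -/

variable (W) in
/-- The comultiplication `Δ` of `S(W)` as the algebra morphism to the graded tensor product
(with `(a ⊗ b)(a' ⊗ b') = (-1)^{|b||a'|} aa' ⊗ bb'`) with `Δ w = w ⊗ 1 + 1 ⊗ w` on `W`. Thus
`Δ(w₁ ⊙ ⋯ ⊙ wₙ)` is the sum over all `j` and all `(j, n-j)`-shuffles `σ` of
`ε(σ) (w_{σ(1)} ⊙ ⋯ ⊙ w_{σ(j)}) ⊗ (w_{σ(j+1)} ⊙ ⋯ ⊙ w_{σ(n)})`. -/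
def comulAlg : Sym W →ₐ[k] (gr W ᵍ⊗[k] gr W) :=
  lift ((GradedTensorProduct.includeLeft (gr W) (gr W)).toLinearMap ∘ₗ ι W +
      (GradedTensorProduct.includeRight (gr W) (gr W)).toLinearMap ∘ₗ ι W) (by
    intro i j a b ha hb
    have key : ∀ {i j : ℤ} {a b : W}, a ∈ W.gr i → b ∈ W.gr j →
        ((1 : Sym W) ᵍ⊗ₜ[k] ι W a * ι W b ᵍ⊗ₜ[k] (1 : Sym W) : gr W ᵍ⊗[k] gr W) =
          ((-1 : ℤˣ) ^ (i * j)) • (ι W b ᵍ⊗ₜ[k] ι W a) := by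
      intro i j a b ha hb
      have := GradedTensorProduct.tmul_coe_mul_coe_tmul (R := k) (gr W) (gr W) 1
        ⟨ι W a, ι_mem_gr ha⟩ ⟨ι W b, ι_mem_gr hb⟩ 1
      simpa using this
    have key2 : ∀ a b : W,
        (ι W a ᵍ⊗ₜ[k] (1 : Sym W) * (1 : Sym W) ᵍ⊗ₜ[k] ι W b : gr W ᵍ⊗[k] gr W) =
          ι W a ᵍ⊗ₜ[k] ι W b :=
      fun a b => GradedTensorProduct.tmul_one_mul_one_tmul _ _ _ _
    have hl := congrArg (GradedTensorProduct.includeLeft (gr W) (gr W)) (ι_mul_ι ha hb)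
    have hr := congrArg (GradedTensorProduct.includeRight (gr W) (gr W)) (ι_mul_ι ha hb)
    rw [map_mul, AlgHom.map_smul_of_tower, map_mul] at hl hr
    simp only [LinearMap.add_apply, LinearMap.comp_apply, AlgHom.toLinearMap_apply, add_mul,
      mul_add, smul_add]
    rw [hl, hr]
    simp only [GradedTensorProduct.includeLeft_apply, GradedTensorProduct.includeRight_apply]
    rw [key ha hb, key hb ha, key2, key2, smul_smul, mul_comm j i, Int.units_mul_self, one_smul]
    abel)

variable (W) in
/-- The comultiplication `Δ : S(W) → S(W) ⊗ S(W)`. -/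
def comul : Sym W →ₗ[k] Sym W ⊗[k] Sym W :=
  (GradedTensorProduct.of k (gr W) (gr W)).symm.toLinearMap ∘ₗ (comulAlg W).toLinearMap

theorem comul_ι (w : W) : comul W (ι W w) = ι W w ⊗ₜ 1 + 1 ⊗ₜ ι W w := by
  simp only [comul, comulAlg, LinearMap.comp_apply, AlgHom.toLinearMap_apply, lift_ι]
  rfl

theorem comul_one : comul W 1 = 1 ⊗ₜ 1 := by
  simp only [comul, LinearMap.comp_apply, AlgHom.toLinearMap_apply, map_one]
  rfl

/-- The map `S(f) : S(V) → S(W)` induced by a linear map `f` of degree zero. -/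
def map {V W : GrMod.{u} k} (f : V →ₗ[k] W) (hf : GrMod.HasDegree V.gr W.gr 0 f) :
    Sym V →ₐ[k] Sym W :=
  lift (ι W ∘ₗ f) fun i j a b ha hb =>
    ι_mul_ι (by simpa using hf i a ha) (by simpa using hf j b hb)

@[simp]
theorem map_ι {V W : GrMod.{u} k} (f : V →ₗ[k] W) (hf : GrMod.HasDegree V.gr W.gr 0 f) (v : V) :
    map f hf (ι V v) = ι W (f v) := by
  simp [map]

theorem map_hasDegree {V W : GrMod.{u} k} (f : V →ₗ[k] W)
    (hf : GrMod.HasDegree V.gr W.gr 0 f) :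
    GrMod.HasDegree (gr V) (gr W) 0 (map f hf).toLinearMap := by
  intro d x hx
  rw [add_zero]
  induction hx using Submodule.span_induction with
  | mem x hx =>
    obtain ⟨l, rfl, rfl⟩ := hx
    refine Submodule.subset_span ⟨l.map fun a => ⟨a.1, f a.2, by simpa using hf a.1 _ a.2.2⟩, ?_, ?_⟩
    · simp [Function.comp_def]
    · simp [map_list_prod, Function.comp_def]
  | zero => simp
  | add x y _ _ ihx ihy => rw [_root_.map_add]; exact add_mem ihx ihy
  | smul c x _ ih => rw [_root_.map_smul]; exact Submodule.smul_mem _ _ ih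

theorem map_comul {V W : GrMod.{u} k} (f : V →ₗ[k] W)
    (hf : GrMod.HasDegree V.gr W.gr 0 f) :
    comul W ∘ₗ (map f hf).toLinearMap =
      TensorProduct.map (map f hf).toLinearMap (map f hf).toLinearMap ∘ₗ comul V := by
  let L := GradedTensorProduct.lift (gr V) (gr V)
    ((GradedTensorProduct.includeLeft (gr W) (gr W)).comp (map f hf))
    ((GradedTensorProduct.includeRight (gr W) (gr W)).comp (map f hf)) (by
      intro i j a b
      have ha : map f hf a ∈ gr W i := by simpa using map_hasDegree f hf i a a.2
      have hb : map f hf b ∈ gr W j := by simpa using map_hasDegree f hf j b b.2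
      have := GradedTensorProduct.tmul_coe_mul_coe_tmul (R := k) (gr W) (gr W) 1
        ⟨map f hf b, hb⟩ ⟨map f hf a, ha⟩ 1
      simp only [AlgHom.comp_apply, GradedTensorProduct.includeLeft_apply,
        GradedTensorProduct.includeRight_apply]
      simp only [one_mul, mul_one] at this
      rw [this, GradedTensorProduct.tmul_one_mul_one_tmul, smul_smul, Int.units_mul_self,
        one_smul])
  have hL : ∀ x : Sym V ⊗[k] Sym V, (GradedTensorProduct.of k (gr W) (gr W)).symm
      (L (GradedTensorProduct.of k (gr V) (gr V) x)) =
        TensorProduct.map (map f hf).toLinearMap (map f hf).toLinearMap x := by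
    intro x
    induction x using TensorProduct.induction_on with
    | zero => simp
    | tmul a b =>
      simp only [TensorProduct.map_tmul, AlgHom.toLinearMap_apply]
      rw [GradedTensorProduct.lift_tmul]
      simp only [AlgHom.comp_apply, GradedTensorProduct.includeLeft_apply,
        GradedTensorProduct.includeRight_apply]
      rw [GradedTensorProduct.tmul_one_mul_one_tmul]
      rfl
    | add x y hx hy => simp only [_root_.map_add, hx, hy]
  have h : (comulAlg W).comp (map f hf) = L.comp (comulAlg V) := by
    refine algHom_ext fun v => ?_
    simp only [AlgHom.comp_apply, map_ι, comulAlg, lift_ι, LinearMap.add_apply,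
      LinearMap.comp_apply, AlgHom.toLinearMap_apply, _root_.map_add,
      GradedTensorProduct.includeLeft_apply, GradedTensorProduct.includeRight_apply]
    simp only [L]
    rw [GradedTensorProduct.lift_tmul, GradedTensorProduct.lift_tmul, map_one, map_one, mul_one,
      one_mul]
    simp
  refine LinearMap.ext fun x => ?_
  rw [LinearMap.comp_apply, LinearMap.comp_apply, ← hL]
  exact congrArg (GradedTensorProduct.of k (gr W) (gr W)).symm (DFunLike.congr_fun h x)

/-! ### Vector fields and their Taylor coefficients -/

/-- The Taylor coefficient of order zero, `Q₀ = pr_W (Q 1)`. -/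
def constPart {V W : GrMod.{u} k} (Q : Sym V →ₗ[k] Sym W) : W := pr W (Q 1)

/-- The Taylor coefficient of order one, `Q₁ : V → S(V) → S(W) → W`. -/
def linPart {V W : GrMod.{u} k} (Q : Sym V →ₗ[k] Sym W) : V →ₗ[k] W := pr W ∘ₗ Q ∘ₗ ι V

/-- A vector field of degree `j` on `W`: a coderivation of degree `j` of `(S(W), Δ)`, i.e.
`Δ ∘ Q = (Q ⊗ 1 + 1 ⊗ Q) ∘ Δ`, where `(1 ⊗ Q)(a ⊗ b) = (-1)^{j|a|} a ⊗ Q b`. -/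
structure IsVectorField (W : GrMod.{u} k) (j : ℤ) (Q : Sym W →ₗ[k] Sym W) : Prop where
  degree : GrMod.HasDegree (gr W) (gr W) j Q
  coderivation : comul W ∘ₗ Q =
    (TensorProduct.map Q LinearMap.id + TensorProduct.map (GrMod.koszul (gr W) j) Q) ∘ₗ comul W

/-- A DG structure on `W`: a vector field `Q` of degree `1` with `[Q, Q] = 2 Q ∘ Q = 0`. -/
structure IsDGStructure (W : GrMod.{u} k) (Q : Sym W →ₗ[k] Sym W) : Prop
    extends IsVectorField W 1 Q where
  sq_zero : Q ∘ₗ Q = 0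

/-- The vector field on `W` with Taylor coefficients `Qₙ = q|_{W^{⊙n}}`:
`Q(w₁ ⊙ ⋯ ⊙ wₙ)` is the sum over all `l` and all `(l, n-l)`-shuffles `σ` of
`ε(σ) q(w_{σ(1)} ⊙ ⋯ ⊙ w_{σ(l)}) ⊙ w_{σ(l+1)} ⊙ ⋯ ⊙ w_{σ(n)}`. -/
def ofTaylor (W : GrMod.{u} k) (q : Sym W →ₗ[k] W) : Sym W →ₗ[k] Sym W :=
  LinearMap.mul' k (Sym W) ∘ₗ TensorProduct.map (ι W ∘ₗ q) LinearMap.id ∘ₗ comul W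

/-- A vector field on `V`, as a vector field on `V × W`:
`Qₙ((v₁, w₁), …, (vₙ, wₙ)) = (Qₙ(v₁, …, vₙ), 0)`. -/
def extendLeft (V W : GrMod.{u} k) (Q : Sym V →ₗ[k] Sym V) :
    Sym (V.prod W) →ₗ[k] Sym (V.prod W) :=
  ofTaylor (V.prod W) (LinearMap.inl k V W ∘ₗ pr V ∘ₗ Q ∘ₗ
    (map (LinearMap.fst k V W) (GrMod.hasDegree_fst V W)).toLinearMap)

/-- A vector field on `W`, as a vector field on `V × W`:
`Qₙ((v₁, w₁), …, (vₙ, wₙ)) = (0, Qₙ(w₁, …, wₙ))`. -/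
def extendRight (V W : GrMod.{u} k) (Q : Sym W →ₗ[k] Sym W) :
    Sym (V.prod W) →ₗ[k] Sym (V.prod W) :=
  ofTaylor (V.prod W) (LinearMap.inr k V W ∘ₗ pr W ∘ₗ Q ∘ₗ
    (map (LinearMap.snd k V W) (GrMod.hasDegree_snd V W)).toLinearMap)

end Sym

/-! ### Formal DG manifolds -/

variable (k) in
/-- A formal DG manifold `(M, Q^M)`. -/
structure DGManifold where
  toGrMod : GrMod.{u} k
  Q : Sym toGrMod →ₗ[k] Sym toGrMod
  isDG : Sym.IsDGStructure toGrMod Q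

namespace DGManifold

/-- A morphism of formal DG manifolds `M → N`: a formal map of degree `0`, given by the morphism
of coalgebras `S(M) → S(N)` that it induces (of degree `0`, sending `1` to `1`), which commutes
with `Q^M` and `Q^N`. -/
@[ext]
structure Hom (M N : DGManifold.{u} k) where
  toLin : Sym M.toGrMod →ₗ[k] Sym N.toGrMod
  degree : GrMod.HasDegree (Sym.gr M.toGrMod) (Sym.gr N.toGrMod) 0 toLin
  map_one : toLin 1 = 1
  comul : Sym.comul N.toGrMod ∘ₗ toLin = TensorProduct.map toLin toLin ∘ₗ Sym.comul M.toGrMod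
  equivariant : toLin ∘ₗ M.Q = N.Q ∘ₗ toLin

/-- The category `DG-Manf` of formal DG manifolds. -/
instance : Category (DGManifold.{u} k) where
  Hom := Hom
  id M :=
    { toLin := LinearMap.id
      degree := fun i x hx => by simpa using hx
      map_one := rfl
      comul := by simp
      equivariant := rfl }
  comp f g :=
    { toLin := g.toLin ∘ₗ f.toLin
      degree := fun i x hx => by simpa using g.degree _ _ (f.degree _ _ hx)
      map_one := by simp [f.map_one, g.map_one]
      comul := by
        rw [← LinearMap.comp_assoc, g.comul, LinearMap.comp_assoc, f.comul,
          ← LinearMap.comp_assoc, ← TensorProduct.map_comp]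
      equivariant := by
        rw [LinearMap.comp_assoc, f.equivariant, ← LinearMap.comp_assoc, g.equivariant,
          LinearMap.comp_assoc] }

/-- `M` is local (`M ∈ DG-Manf^L`) if `Q^M₀ = 0`. -/
def IsLocal (M : DGManifold.{u} k) : Prop := Sym.constPart M.Q = 0

/-- `(M, Q^M₁)` is contractible: there is a linear map `h` of degree `-1` with
`Q₁ h + h Q₁ = id`. -/
def IsContractible (M : DGManifold.{u} k) : Prop :=
  ∃ h : M.toGrMod →ₗ[k] M.toGrMod, GrMod.HasDegree M.toGrMod.gr M.toGrMod.gr (-1) h ∧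
    Sym.linPart M.Q ∘ₗ h + h ∘ₗ Sym.linPart M.Q = LinearMap.id

end DGManifold

/-! ### Deformations -/

/-- The sum `Q^B + Q^M + Q` of vector fields on `B × M`. -/
def totalField (M B : DGManifold.{u} k)
    (Q : Sym (B.toGrMod.prod M.toGrMod) →ₗ[k] Sym (B.toGrMod.prod M.toGrMod)) :
    Sym (B.toGrMod.prod M.toGrMod) →ₗ[k] Sym (B.toGrMod.prod M.toGrMod) :=
  Sym.extendLeft B.toGrMod M.toGrMod B.Q + Sym.extendRight B.toGrMod M.toGrMod M.Q + Q

/-- The inclusion `M = {0} × M → B × M`, as a map `S(M) → S(B × M)`. -/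
def incl (B M : GrMod.{u} k) : Sym M →ₐ[k] Sym (B.prod M) :=
  Sym.map (LinearMap.inr k B M) (GrMod.hasDegree_inr B M)

/-- The projection `B × M → B`, as a map `S(B × M) → S(B)`. -/
def projBase (B M : GrMod.{u} k) : Sym (B.prod M) →ₐ[k] Sym B :=
  Sym.map (LinearMap.fst k B M) (GrMod.hasDegree_fst B M)

/-- The projection `B × M → M`, as a map `S(B × M) → S(M)`. -/
def projFibre (B M : GrMod.{u} k) : Sym (B.prod M) →ₐ[k] Sym M :=
  Sym.map (LinearMap.snd k B M) (GrMod.hasDegree_snd B M)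

/-- A deformation `(B, Q^B, Q)` of `(M, Q^M)` with base `(B, Q^B) ∈ DG-Manf^L`: a vector field
`Q` of degree `1` on `B × M` with `Q₀ = 0` and `Q|_{{0} × M} = 0`, such that
`Q̃ = Q^B + Q^M + Q` is a DG structure on `B × M` and the projection
`(B × M, Q̃) → (B, Q^B)` is a morphism of formal DG manifolds. -/
structure Deformation (M B : DGManifold.{u} k) where
  isLocal_base : B.IsLocal
  Q : Sym (B.toGrMod.prod M.toGrMod) →ₗ[k] Sym (B.toGrMod.prod M.toGrMod)
  isVectorField : Sym.IsVectorField (B.toGrMod.prod M.toGrMod) 1 Q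
  constPart_eq_zero : Sym.constPart Q = 0
  restrict_eq_zero : Q ∘ₗ (incl B.toGrMod M.toGrMod).toLinearMap = 0
  isDG : Sym.IsDGStructure (B.toGrMod.prod M.toGrMod) (totalField M B Q)
  proj_equivariant : (projBase B.toGrMod M.toGrMod).toLinearMap ∘ₗ totalField M B Q =
    B.Q ∘ₗ (projBase B.toGrMod M.toGrMod).toLinearMap

namespace Deformation

variable {M B B' : DGManifold.{u} k}

/-- The total space `(B × M, Q̃)`. -/
def total (D : Deformation M B) : DGManifold.{u} k where
  toGrMod := B.toGrMod.prod M.toGrMod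
  Q := totalField M B D.Q
  isDG := D.isDG

/-- The projection `(B × M, Q̃) → (B, Q^B)`. -/
def proj (D : Deformation M B) : D.total ⟶ B :=
  ({ toLin := (projBase B.toGrMod M.toGrMod).toLinearMap
     degree := Sym.map_hasDegree _ _
     map_one := map_one (projBase B.toGrMod M.toGrMod)
     comul := Sym.map_comul _ _
     equivariant := D.proj_equivariant } : DGManifold.Hom D.total B)

/-- A deformation is trivial if the projection `B × M → M` respects `Q̃` and `Q^M`. -/
def IsTrivial (D : Deformation M B) : Prop :=
  (projFibre B.toGrMod M.toGrMod).toLinearMap ∘ₗ totalField M B D.Q =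
    M.Q ∘ₗ (projFibre B.toGrMod M.toGrMod).toLinearMap

/-- A morphism `(F, f)` of deformations of `M`: the square formed by `F`, `f` and the projections
to the bases is cartesian in `DG-Manf`, and `F` is compatible with the inclusions of `M`. -/
structure Hom (D : Deformation M B) (D' : Deformation M B') where
  F : D.total ⟶ D'.total
  f : B ⟶ B'
  cartesian : IsPullback F D.proj D'.proj f
  incl_comp : DGManifold.Hom.toLin F ∘ₗ (incl B.toGrMod M.toGrMod).toLinearMap =
    (incl B'.toGrMod M.toGrMod).toLinearMap

/-- An isomorphism of deformations: a morphism of deformations with a two-sided inverse (with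
respect to the componentwise composition). -/
structure Iso (D : Deformation M B) (D' : Deformation M B') where
  hom : Hom D D'
  inv : Hom D' D
  hom_inv_F : hom.F ≫ inv.F = 𝟙 D.total
  hom_inv_f : hom.f ≫ inv.f = 𝟙 B
  inv_hom_F : inv.F ≫ hom.F = 𝟙 D'.total
  inv_hom_f : inv.f ≫ hom.f = 𝟙 B'

end Deformation

end FormalDG

end

/-! Extend the contraction `h` to a linear vector field `H` of degree -1 on `B × M`, and put `E =
Q̃H + HQ̃`. This is a vector field of degree 0 that commutes with `Q̃` because `Q̃² = 0`. It kills
`S(M)`, and it lies over `E_B = Q^B h + h Q^B`, whose linear part is the identity by the contraction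
identity. Hence `E` is triangular for the filtration of `S(B × M)` by the number of letters in `B`,
with eigenvalue `n` on the `n`-th graded piece (`IsVectorField.isTriangular`). The same holds for
`E₀`, which is `E_B` regarded as a field on `B × M`.

Differences of distinct natural numbers are invertible in `k`, so `S(B × M)` is the direct sum of
the eigenspaces of `E`, and also of those of `E₀`. Mapping the `n`-eigenspace of `E` to that of `E₀`
by the `E₀`-eigenprojection gives a map `F` that is the identity on the associated graded module,
hence bijective (`exists_intertwiner`). Whatever is compatible with both `E` and `E₀` is compatible
with `F`, because an `n`-eigenvector that is a sum of eigenvectors of smaller eigenvalue is zero. So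
`F` preserves degree and comultiplication, lies over `B` and fixes `S(M)`.

The projection to `M` composed with `F` kills every eigenspace with `n ≠ 0`, while the 0-eigenspace
of `E` is `S(M)`, on which `Q̃` is `Q^M`. As `Q̃` preserves eigenspaces, this composite intertwines
`Q̃` and `Q^M`. Thus `F Q̃ F⁻¹` projects to both `Q^B` and `Q^M`. A vector field is determined by
its Taylor coefficients (`IsCoderivationAlong.eq_zero`), so `F Q̃ F⁻¹ = Q^B + Q^M`. -/

noncomputable section

namespace FormalDG

section

/-! ### Signs and maps of graded modules -/

variable {k : Type v} [CommRing k]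

variable (k) in
/-- The sign `(-1)^n` as a scalar. -/
def sgn (n : ℤ) : k := (((-1 : ℤˣ) ^ n : ℤˣ) : ℤ)

variable (k) in
theorem units_smul_eq_sgn_smul {A : Type*} [AddCommGroup A] [Module k A] (n : ℤ) (x : A) :
    ((-1 : ℤˣ) ^ n) • x = sgn k n • x := by
  rw [sgn, Units.smul_def, Int.cast_smul_eq_zsmul]

theorem sgn_zero : sgn k 0 = 1 := by simp [sgn]

theorem sgn_add (m n : ℤ) : sgn k (m + n) = sgn k m * sgn k n := by
  simp [sgn, zpow_add]

theorem sgn_mul_self (n : ℤ) : sgn k n * sgn k n = 1 := by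
  rw [sgn, ← Int.cast_mul, ← Units.val_mul, Int.units_mul_self]
  simp

theorem sgn_one : sgn k 1 = -1 := by simp [sgn]

theorem sgn_neg (n : ℤ) : sgn k (-n) = sgn k n := by
  simp [sgn]

namespace GrMod

section

variable {A B : Type*} [AddCommGroup A] [Module k A] [AddCommGroup B] [Module k B]
  {𝒜 : ℤ → Submodule k A} {ℬ : ℤ → Submodule k B}

theorem HasDegree.comp {C : Type*} [AddCommGroup C] [Module k C] {𝒞 : ℤ → Submodule k C}
    {i j l : ℤ} {g : B →ₗ[k] C} {f : A →ₗ[k] B} (hg : HasDegree ℬ 𝒞 j g) (hf : HasDegree 𝒜 ℬ i f)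
    (h : i + j = l) : HasDegree 𝒜 𝒞 l (g ∘ₗ f) := fun d x hx => by
  rw [← h, ← add_assoc]
  exact hg _ _ (hf _ _ hx)

theorem HasDegree.add {j : ℤ} {f g : A →ₗ[k] B} (hf : HasDegree 𝒜 ℬ j f)
    (hg : HasDegree 𝒜 ℬ j g) : HasDegree 𝒜 ℬ j (f + g) :=
  fun d x hx => add_mem (hf d x hx) (hg d x hx)

theorem HasDegree.sub {j : ℤ} {f g : A →ₗ[k] B} (hf : HasDegree 𝒜 ℬ j f)
    (hg : HasDegree 𝒜 ℬ j g) : HasDegree 𝒜 ℬ j (f - g) :=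
  fun d x hx => sub_mem (hf d x hx) (hg d x hx)

end

section

variable {A B : Type*} [AddCommGroup A] [Module k A] [AddCommGroup B] [Module k B]
  (𝒜 : ℤ → Submodule k A) [DirectSum.Decomposition 𝒜]
  (ℬ : ℤ → Submodule k B) [DirectSum.Decomposition ℬ]

theorem hom_ext_of_mem {f g : A →ₗ[k] B} (h : ∀ i, ∀ x ∈ 𝒜 i, f x = g x) : f = g :=
  DirectSum.decompose_lhom_ext 𝒜 fun i => LinearMap.ext fun x => h i x x.2

theorem koszul_apply_of_mem (j : ℤ) {i : ℤ} {x : A} (hx : x ∈ 𝒜 i) :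
    koszul 𝒜 j x = sgn k (j * i) • x := by
  rw [koszul_of_mem 𝒜 j hx, units_smul_eq_sgn_smul k]

theorem koszul_zero : koszul 𝒜 0 = LinearMap.id :=
  hom_ext_of_mem 𝒜 fun i x hx => by
    rw [koszul_apply_of_mem 𝒜 0 hx, zero_mul, sgn_zero, one_smul, LinearMap.id_apply]

theorem koszul_comp_koszul (i j : ℤ) : koszul 𝒜 i ∘ₗ koszul 𝒜 j = koszul 𝒜 (i + j) :=
  hom_ext_of_mem 𝒜 fun d x hx => by
    rw [LinearMap.comp_apply, koszul_apply_of_mem 𝒜 j hx, map_smul, koszul_apply_of_mem 𝒜 _ hx,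
      koszul_apply_of_mem 𝒜 _ hx, smul_smul, add_mul, sgn_add, mul_comm]

theorem koszul_koszul (i j : ℤ) (x : A) : koszul 𝒜 i (koszul 𝒜 j x) = koszul 𝒜 (i + j) x :=
  LinearMap.congr_fun (koszul_comp_koszul 𝒜 i j) x

theorem koszul_neg (j : ℤ) : koszul 𝒜 (-j) = koszul 𝒜 j :=
  hom_ext_of_mem 𝒜 fun d x hx => by
    rw [koszul_apply_of_mem 𝒜 _ hx, koszul_apply_of_mem 𝒜 _ hx, neg_mul, sgn_neg]

variable {𝒜 ℬ}

theorem HasDegree.map_koszul {j : ℤ} {f : A →ₗ[k] B} (hf : HasDegree 𝒜 ℬ j f) (i : ℤ) (x : A) :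
    f (koszul 𝒜 i x) = sgn k (i * j) • koszul ℬ i (f x) := by
  have h : f ∘ₗ koszul 𝒜 i = sgn k (i * j) • koszul ℬ i ∘ₗ f :=
    hom_ext_of_mem 𝒜 fun d x hx => by
      rw [LinearMap.comp_apply, LinearMap.smul_apply, LinearMap.comp_apply,
        koszul_apply_of_mem 𝒜 _ hx, map_smul, koszul_apply_of_mem ℬ _ (hf d x hx), smul_smul,
        mul_add, sgn_add, mul_left_comm, sgn_mul_self, mul_one]
  exact LinearMap.congr_fun h x

theorem HasDegree.koszul_map {j : ℤ} {f : A →ₗ[k] B} (hf : HasDegree 𝒜 ℬ j f) (i : ℤ) (x : A) :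
    koszul ℬ i (f x) = sgn k (i * j) • f (koszul 𝒜 i x) := by
  rw [hf.map_koszul, smul_smul, sgn_mul_self, one_smul]

/-- Applied to vector fields of degree 0, this says that they commute with the homogeneous
projections; it is how the intertwiner acquires degree 0. -/
theorem HasDegree.decompose_apply {f : A →ₗ[k] B} (hf : HasDegree 𝒜 ℬ 0 f) (d : ℤ) (x : A) :
    (DirectSum.decompose ℬ (f x) d : B) = f (DirectSum.decompose 𝒜 x d) := by
  induction x using DirectSum.Decomposition.inductionOn 𝒜 with
  | zero => simp
  | @homogeneous i m =>
    have hm : f m ∈ ℬ i := by simpa using hf i m m.2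
    by_cases h : i = d
    · subst h
      rw [DirectSum.decompose_of_mem_same _ hm, DirectSum.decompose_of_mem_same _ m.2]
    · rw [DirectSum.decompose_of_mem_ne _ hm h, DirectSum.decompose_of_mem_ne _ m.2 h, map_zero]
  | add x y hx hy => simp [hx, hy]

end

end GrMod

/-! ### Induction on words and the recursion for the comultiplication -/

namespace Sym

variable {W : GrMod.{u} k}

@[elab_as_elim]
theorem induction {p : Sym W → Prop} (one : p 1)
    (mul : ∀ (i : ℤ) (w : W), w ∈ W.gr i → ∀ x, p x → p (ι W w * x))
    (add : ∀ x y, p x → p y → p (x + y)) (smul : ∀ (c : k) x, p x → p (c • x)) (x : Sym W) :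
    p x := by
  have zero : p 0 := by simpa using smul 0 1 one
  induction x using DirectSum.Decomposition.inductionOn (gr W) with
  | zero => exact zero
  | @homogeneous i m =>
    obtain ⟨m, hm⟩ := m
    dsimp only
    induction hm using Submodule.span_induction with
    | mem x hx =>
      obtain ⟨l, -, rfl⟩ := hx
      induction l with
      | nil => simpa using one
      | cons a l ih =>
        rw [List.map_cons, List.prod_cons]
        exact mul _ _ a.2.2 _ ih
    | zero => exact zero
    | add x y _ _ hx hy => exact add _ _ hx hy
    | smul c x _ hx => exact smul _ _ hx
  | add x y hx hy => exact add _ _ hx hy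

variable (W) in
/-- Left multiplication by an element of `W`. -/
def mulι (w : W) : Sym W →ₗ[k] Sym W := LinearMap.mulLeft k (ι W w)

@[simp]
theorem mulι_apply (w : W) (x : Sym W) : mulι W w x = ι W w * x := rfl

theorem linearMap_ext {Z : Type*} [AddCommGroup Z] [Module k Z] {f g : Sym W →ₗ[k] Z}
    (one : f 1 = g 1)
    (mul : ∀ (i : ℤ) (w : W), w ∈ W.gr i → ∀ x, f x = g x → f (ι W w * x) = g (ι W w * x)) :
    f = g := by
  refine LinearMap.ext fun x => ?_
  induction x using induction with
  | one => exact one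
  | mul i w hw x ih => exact mul i w hw x ih
  | add x y hx hy => rw [map_add, map_add, hx, hy]
  | smul c x hx => rw [_root_.map_smul, _root_.map_smul, hx]

theorem hasDegree_mulι {i : ℤ} {w : W} (hw : w ∈ W.gr i) :
    GrMod.HasDegree (gr W) (gr W) i (mulι W w) := fun d x hx => by
  rw [add_comm]
  exact SetLike.GradedMul.mul_mem (ι_mem_gr hw) hx

theorem mem_gr_mul {i j : ℤ} {x y : Sym W} (hx : x ∈ gr W i) (hy : y ∈ gr W j) :
    x * y ∈ gr W (i + j) := SetLike.GradedMul.mul_mem hx hy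

theorem ι_mul_of_mem {i j : ℤ} {w : W} (hw : w ∈ W.gr i) {a : W} (ha : a ∈ W.gr j) (y : Sym W) :
    ι W w * (ι W a * y) = sgn k (i * j) • (ι W a * (ι W w * y)) := by
  rw [← mul_assoc, ι_mul_ι hw ha, units_smul_eq_sgn_smul k, smul_mul_assoc, mul_assoc]

theorem koszul_one (j : ℤ) : GrMod.koszul (gr W) j 1 = 1 := by
  rw [GrMod.koszul_apply_of_mem (gr W) j (SetLike.GradedOne.one_mem), mul_zero, sgn_zero, one_smul]

theorem koszul_ι_mul (j : ℤ) {i : ℤ} {w : W} (hw : w ∈ W.gr i) (x : Sym W) :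
    GrMod.koszul (gr W) j (ι W w * x) = sgn k (j * i) • (ι W w * GrMod.koszul (gr W) j x) :=
  (hasDegree_mulι hw).koszul_map j x

/-- `Δ` is multiplicative for the graded tensor product, where `(1 ⊗ w)(a ⊗ b) = (-1)^{|w||a|} a ⊗
wb`; the sign is the `koszul` factor. This recursion takes the place of sums over shuffles. -/
theorem comul_ι_mul {i : ℤ} {w : W} (hw : w ∈ W.gr i) (x : Sym W) :
    comul W (ι W w * x) = TensorProduct.map (mulι W w) LinearMap.id (comul W x) +
      TensorProduct.map (GrMod.koszul (gr W) i) (mulι W w) (comul W x) := by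
  have h1 : ∀ t : Sym W ⊗[k] Sym W,
      ((ι W w ᵍ⊗ₜ[k] (1 : Sym W) : gr W ᵍ⊗[k] gr W) * GradedTensorProduct.of k (gr W) (gr W) t) =
        GradedTensorProduct.of k (gr W) (gr W)
          (TensorProduct.map (mulι W w) LinearMap.id t) := by
    intro t
    induction t using TensorProduct.induction_on with
    | zero => simp
    | add x y hx hy => simp only [map_add, mul_add, hx, hy]
    | tmul a b =>
      induction a using DirectSum.Decomposition.inductionOn (gr W) with
      | zero => simp
      | homogeneous m => exact GradedTensorProduct.tmul_one_mul_coe_tmul (gr W) (gr W) _ m b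
      | add x y hx hy => simp only [map_add, mul_add, TensorProduct.add_tmul, hx, hy]
  have h2 : ∀ t : Sym W ⊗[k] Sym W,
      (((1 : Sym W) ᵍ⊗ₜ[k] ι W w : gr W ᵍ⊗[k] gr W) * GradedTensorProduct.of k (gr W) (gr W) t) =
        GradedTensorProduct.of k (gr W) (gr W)
          (TensorProduct.map (GrMod.koszul (gr W) i) (mulι W w) t) := by
    intro t
    induction t using TensorProduct.induction_on with
    | zero => simp
    | add x y hx hy => simp only [map_add, mul_add, hx, hy]
    | tmul a b =>
      induction a using DirectSum.Decomposition.inductionOn (gr W) with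
      | zero => simp
      | homogeneous m =>
        refine (GradedTensorProduct.tmul_coe_mul_coe_tmul (gr W) (gr W) 1
          ⟨ι W w, ι_mem_gr hw⟩ m b).trans ?_
        rw [TensorProduct.map_tmul, GrMod.koszul_apply_of_mem (gr W) i m.2,
          ← TensorProduct.smul_tmul', map_smul, units_smul_eq_sgn_smul k, one_mul]
        rfl
      | add x y hx hy => simp only [map_add, mul_add, TensorProduct.add_tmul, hx, hy]
  have h3 : comulAlg W (ι W w) = ι W w ᵍ⊗ₜ[k] (1 : Sym W) + (1 : Sym W) ᵍ⊗ₜ[k] ι W w := by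
    simp only [comulAlg, lift_ι]
    rfl
  have h4 : ∀ y, comul W y = (GradedTensorProduct.of k (gr W) (gr W)).symm (comulAlg W y) :=
    fun y => rfl
  rw [h4, map_mul, h3, add_mul, map_add]
  congr 1
  · exact congrArg (GradedTensorProduct.of k (gr W) (gr W)).symm (h1 (comul W x))
  · exact congrArg (GradedTensorProduct.of k (gr W) (gr W)).symm (h2 (comul W x))

/-! ### The counit and the projection to `W` -/

variable (W) in
/-- The counit of `S(W)`. -/
def counit : Sym W →ₐ[k] k := lift (0 : W →ₗ[k] k) (by intros; simp)

theorem counit_ι_mul (w : W) (x : Sym W) : counit W (ι W w * x) = 0 := by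
  simp [counit]

/-- A word of two or more letters has no linear part, so only the constant term of `x` contributes.
-/
theorem pr_ι_mul (w : W) (x : Sym W) : pr W (ι W w * x) = counit W x • w := by
  have h : pr W ∘ₗ mulι W w = (counit W).toLinearMap.smulRight w := by
    refine linearMap_ext ?_ fun i a _ x _ => ?_
    · simp
    · simp only [LinearMap.comp_apply, mulι_apply, LinearMap.smulRight_apply,
        AlgHom.toLinearMap_apply, counit_ι_mul, zero_smul]
      rw [← mul_assoc, pr_ι_mul_ι_mul]
  exact LinearMap.congr_fun h x

theorem counit_comp_map {V : GrMod.{u} k} (f : V →ₗ[k] W) (hf : GrMod.HasDegree V.gr W.gr 0 f)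
    (x : Sym V) : counit W (map f hf x) = counit V x := by
  have h : (counit W).comp (map f hf) = counit V := algHom_ext fun v => by simp [counit]
  exact DFunLike.congr_fun h x

theorem pr_map {V : GrMod.{u} k} (f : V →ₗ[k] W) (hf : GrMod.HasDegree V.gr W.gr 0 f)
    (x : Sym V) : pr W (map f hf x) = f (pr V x) := by
  have h : pr W ∘ₗ (map f hf).toLinearMap = f ∘ₗ pr V := by
    refine linearMap_ext (by simp) fun i w _ x _ => ?_
    simp [pr_ι_mul, counit_comp_map]
  exact LinearMap.congr_fun h x

theorem counit_eq_zero_of_mem {d : ℤ} (hd : d ≠ 0) {x : Sym W} (hx : x ∈ gr W d) :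
    counit W x = 0 := by
  induction hx using Submodule.span_induction with
  | mem x hx =>
    obtain ⟨l, hl, rfl⟩ := hx
    cases l with
    | nil => exact absurd hl.symm (by simpa using hd)
    | cons a l => rw [List.map_cons, List.prod_cons, counit_ι_mul]
  | zero => simp
  | add x y _ _ hx hy => rw [map_add, hx, hy, add_zero]
  | smul c x _ hx => rw [_root_.map_smul, hx, smul_zero]

variable (W) in
theorem hasDegree_pr : GrMod.HasDegree (gr W) W.gr 0 (pr W) := by
  intro d x hx
  rw [add_zero]
  induction hx using Submodule.span_induction with
  | mem x hx =>
    obtain ⟨l, hl, rfl⟩ := hx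
    cases l with
    | nil => simp
    | cons a l =>
      rw [List.map_cons, List.prod_cons, pr_ι_mul]
      -- The remaining letters contribute only through their counit, which vanishes unless their
      -- total degree is 0.
      by_cases h : (l.map Sigma.fst).sum = 0
      · rw [List.map_cons, List.sum_cons, h, add_zero] at hl
        rw [← hl]
        exact Submodule.smul_mem _ _ a.2.2
      · rw [counit_eq_zero_of_mem h (Submodule.subset_span ⟨l, rfl, rfl⟩), zero_smul]
        exact zero_mem _
  | zero => simp
  | add x y _ _ hx hy => rw [map_add]; exact add_mem hx hy
  | smul c x _ hx => rw [_root_.map_smul]; exact Submodule.smul_mem _ _ hx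

variable (W) in
theorem map_counit_comul (x : Sym W) :
    TensorProduct.map (counit W).toLinearMap LinearMap.id (comul W x) = (1 : k) ⊗ₜ[k] x := by
  have h : TensorProduct.map (counit W).toLinearMap LinearMap.id ∘ₗ comul W =
      TensorProduct.mk k k (Sym W) 1 := by
    refine linearMap_ext (by simp [comul_one]) fun i w hw x hx => ?_
    simp only [LinearMap.comp_apply] at hx ⊢
    rw [comul_ι_mul hw, map_add, TensorProduct.map_map, TensorProduct.map_map]
    have h1 : (counit W).toLinearMap ∘ₗ mulι W w = 0 :=
      LinearMap.ext fun y => counit_ι_mul w y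
    have h2 : (counit W).toLinearMap ∘ₗ GrMod.koszul (gr W) i = (counit W).toLinearMap :=
      linearMap_ext (by simp [koszul_one]) fun j a ha y _ => by
        simp [koszul_ι_mul i ha, counit_ι_mul]
    have h3 : TensorProduct.map (counit W).toLinearMap (mulι W w) =
        LinearMap.lTensor k (mulι W w) ∘ₗ
          TensorProduct.map (counit W).toLinearMap LinearMap.id := by
      rw [LinearMap.lTensor, ← TensorProduct.map_comp]
      rfl
    rw [h1, h2, LinearMap.id_comp, LinearMap.id_comp, h3, LinearMap.comp_apply, hx]
    simp
  exact LinearMap.congr_fun h x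

end Sym

end

section

/-! ### Endomorphisms with eigenvalues in `ℕ` -/

section Eigen

variable {k : Type*} [CommRing k] {X Z : Type*} [AddCommGroup X] [Module k X]
  [AddCommGroup Z] [Module k Z]

/-- The eigenspace of `T` for the eigenvalue `n`. -/
abbrev eig (T : Module.End k X) (n : ℕ) : Submodule k X := T.eigenspace (n : k)

theorem mem_eig {T : Module.End k X} {n : ℕ} {x : X} : x ∈ eig T n ↔ T x = (n : k) • x :=
  Module.End.mem_eigenspace_iff

theorem mem_iSup_eig_of_lt {T : Module.End k X} {m n : ℕ} (h : m < n) {x : X} (hx : x ∈ eig T m) :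
    x ∈ ⨆ m, ⨆ (_ : m < n), eig T m :=
  Submodule.mem_iSup_of_mem m (Submodule.mem_iSup_of_mem h hx)

theorem map_mem_of_mem_iSup_lt (f : X →ₗ[k] Z) {S : Submodule k Z} {P : ℕ → Submodule k X} {n : ℕ}
    {x : X} (hx : x ∈ ⨆ m, ⨆ (_ : m < n), P m) (h : ∀ m < n, ∀ y ∈ P m, f y ∈ S) : f x ∈ S :=
  (iSup_le fun m => iSup_le fun hm => h m hm : ⨆ m, ⨆ (_ : m < n), P m ≤ S.comap f) hx

theorem map_mem_eig {E : Module.End k X} {T : Module.End k Z} {f : X →ₗ[k] Z}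
    (hf : f ∘ₗ E = T ∘ₗ f) {n : ℕ} {x : X} (hx : x ∈ eig E n) : f x ∈ eig T n := by
  have h := LinearMap.congr_fun hf x
  simp only [LinearMap.comp_apply] at h
  rw [mem_eig, ← h, mem_eig.1 hx, map_smul]

/-- The endomorphism `T ⊗ 1 + 1 ⊗ T`. -/
def tensorSum (T : Module.End k X) : Module.End k (X ⊗[k] X) :=
  TensorProduct.map T LinearMap.id + TensorProduct.map LinearMap.id T

theorem tmul_mem_eig_tensorSum {T : Module.End k X} {i j : ℕ} {a b : X} (ha : a ∈ eig T i)
    (hb : b ∈ eig T j) : a ⊗ₜ b ∈ eig (tensorSum T) (i + j) := by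
  rw [mem_eig] at *
  simp [tensorSum, ha, hb, add_smul, TensorProduct.smul_tmul']

/-- Two strict bounds gain one unit: eigenvalues below `i` and `j` add up to at most `i + j - 2`. -/
theorem tmul_mem_iSup_eig_tensorSum {T : Module.End k X} {i j n : ℕ} (hij : i + j ≤ n + 1) {a b : X}
    (ha : a ∈ ⨆ m, ⨆ (_ : m < i), eig T m) (hb : b ∈ ⨆ m, ⨆ (_ : m < j), eig T m) :
    a ⊗ₜ b ∈ ⨆ m, ⨆ (_ : m < n), eig (tensorSum T) m := by
  refine map_mem_of_mem_iSup_lt ((TensorProduct.mk k X X).flip b) ha fun i' hi a ha => ?_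
  refine map_mem_of_mem_iSup_lt (TensorProduct.mk k X X a) hb fun j' hj b hb => ?_
  exact mem_iSup_eig_of_lt (by omega) (tmul_mem_eig_tensorSum ha hb)

variable [Algebra ℚ k]

variable (k) in
theorem isUnit_natCast_sub {m n : ℕ} (h : m ≠ n) : IsUnit ((m : k) - n) := by
  have h1 : IsUnit ((m : ℚ) - n) := (sub_ne_zero.2 (Nat.cast_injective.ne h)).isUnit
  simpa using h1.map (algebraMap ℚ k)

/-- After restriction of scalars to the field `ℚ`, these are contained in eigenspaces of a
`ℚ`-linear map for distinct rational eigenvalues. -/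
theorem iSupIndep_eig (T : Module.End k X) : iSupIndep (eig T) := by
  let _ : Module ℚ X := Module.compHom X (algebraMap ℚ k)
  have hs : ∀ (q : ℚ) (x : X), q • x = algebraMap ℚ k q • x := fun _ _ => rfl
  let f : Module.End ℚ X :=
    { toFun := T
      map_add' := T.map_add
      map_smul' := fun q x => T.map_smul (algebraMap ℚ k q) x }
  have hf : ∀ {n : ℕ} {x : X}, x ∈ eig T n → x ∈ f.eigenspace (n : ℚ) := fun {n x} hx => by
    rw [Module.End.mem_eigenspace_iff, hs, map_natCast]
    exact mem_eig.1 hx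
  have ind := f.eigenspaces_iSupIndep.comp (f := fun n : ℕ => (n : ℚ)) Nat.cast_injective
  intro n
  rw [Submodule.disjoint_def]
  intro x hx hx'
  refine (Submodule.disjoint_def.1 (ind n)) x (hf hx) ?_
  -- Suprema over `k` and over `ℚ` are compared as additive submonoids, where the scalars no longer
  -- matter.
  let S : AddSubmonoid X := (⨆ m, ⨆ (_ : m ≠ n), f.eigenspace (m : ℚ)).toAddSubmonoid
  have hS : (⨆ m, ⨆ (_ : m ≠ n), eig T m).toAddSubmonoid ≤ S := by
    simp only [Submodule.iSup_toAddSubmonoid]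
    refine iSup_le fun m => iSup_le fun hm y hy => ?_
    exact Submodule.mem_iSup_of_mem m (Submodule.mem_iSup_of_mem hm (hf hy))
  exact hS hx'

/-- The rigidity behind all compatibilities of the intertwiner: a discrepancy is shown to have
eigenvalue `n` and also to be a sum of eigenvectors of smaller eigenvalue. -/
theorem eq_zero_of_mem_eig {T : Module.End k X} {n : ℕ} {x : X} (hx : x ∈ eig T n)
    (hx' : x ∈ ⨆ m, ⨆ (_ : m < n), eig T m) : x = 0 :=
  Submodule.disjoint_def.1 (iSupIndep_eig T n) x hx
    ((iSup_mono fun _ => iSup_mono' fun h => ⟨h.ne, le_rfl⟩ :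
      (⨆ m, ⨆ (_ : m < n), eig T m) ≤ ⨆ m, ⨆ (_ : m ≠ n), eig T m) hx')

theorem eig_le_of_iSup_eq_top {T : Module.End k X} {P : ℕ → Submodule k X}
    (hP : ∀ n, P n ≤ eig T n) (htop : ⨆ n, P n = ⊤) (n : ℕ) : eig T n ≤ P n := by
  intro x hx
  have h : x ∈ P n ⊔ ⨆ m, ⨆ (_ : m ≠ n), P m := by
    rw [← iSup_split_single P n, htop]
    trivial
  obtain ⟨a, ha, b, hb, rfl⟩ := Submodule.mem_sup.1 h
  have hb' : b ∈ eig T n := by simpa using sub_mem hx (hP n ha)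
  have : b = 0 := Submodule.disjoint_def.1 (iSupIndep_eig T n) b hb'
    ((iSup_mono fun m => iSup_mono fun _ => hP m :
      (⨆ m, ⨆ (_ : m ≠ n), P m) ≤ ⨆ m, ⨆ (_ : m ≠ n), eig T m) hb)
  rwa [this, add_zero]

/-- On the exhaustive filtration `Fil`, the endomorphism `E` acts on the quotient
`Fil (n + 1) / Fil n` as multiplication by `n`. -/
structure IsTriangular (Fil : ℕ → Submodule k X) (E : Module.End k X) : Prop where
  mono : Monotone Fil
  zero : Fil 0 = ⊥
  exhaustive : ∀ x, ∃ n, x ∈ Fil n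
  lower : ∀ n, ∀ x ∈ Fil (n + 1), E x - (n : k) • x ∈ Fil n

namespace IsTriangular

variable {Fil : ℕ → Submodule k X} {E E₀ : Module.End k X}

/-- `E - n` maps `Fil (n + 1)` into `Fil n` and is onto on the sum of the eigenspaces below `n`,
where it acts by the units `m - n`. So some `z` in that sum makes `x - z` an `n`-eigenvector. -/
theorem le_iSup_eig (h : IsTriangular Fil E) (n : ℕ) : Fil n ≤ ⨆ m, ⨆ (_ : m < n), eig E m := by
  induction n with
  | zero => rw [h.zero]; exact bot_le
  | succ n ih =>
    have key : ∀ y ∈ ⨆ m, ⨆ (_ : m < n), eig E m,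
        y ∈ (⨆ m, ⨆ (_ : m < n), eig E m).map (E - (n : k) • LinearMap.id) := by
      intro y hy
      refine map_mem_of_mem_iSup_lt LinearMap.id hy fun m hm x hx => ?_
      obtain ⟨c, hc⟩ := isUnit_natCast_sub k hm.ne
      refine ⟨(↑c⁻¹ : k) • x, mem_iSup_eig_of_lt hm (Submodule.smul_mem _ _ hx), ?_⟩
      rw [map_smul, LinearMap.sub_apply, mem_eig.1 hx, LinearMap.smul_apply, LinearMap.id_apply,
        ← sub_smul, ← hc, smul_smul]
      simp
    intro x hx
    obtain ⟨z, hz, hzx⟩ := key _ (ih (h.lower n x hx))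
    have h1 : x - z ∈ eig E n := by
      rw [mem_eig, map_sub, smul_sub, sub_eq_sub_iff_sub_eq_sub]
      simpa using hzx.symm
    have h2 : (⨆ m, ⨆ (_ : m < n), eig E m) ≤ ⨆ m, ⨆ (_ : m < n + 1), eig E m :=
      iSup_mono fun _ => iSup_mono' fun h => ⟨h.trans n.lt_succ_self, le_rfl⟩
    simpa using add_mem (mem_iSup_eig_of_lt n.lt_succ_self h1) (h2 hz)

/-- For an `n`-eigenvector in `Fil (N + 1)` with `N > n`, triangularity puts `(n - N) x` in `Fil N`,
and `n - N` is a unit; descend until `N = n`. -/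
theorem eig_le (h : IsTriangular Fil E) (n : ℕ) : eig E n ≤ Fil (n + 1) := by
  intro x hx
  obtain ⟨m, hm⟩ := h.exhaustive x
  have key : ∀ d, x ∈ Fil (n + 1 + d) → x ∈ Fil (n + 1) := by
    intro d
    induction d with
    | zero => exact id
    | succ d ih =>
      intro hd
      refine ih ?_
      have h1 := h.lower (n + 1 + d) x hd
      obtain ⟨c, hc⟩ := isUnit_natCast_sub k (show n ≠ n + 1 + d by omega)
      rw [mem_eig.1 hx, ← sub_smul, ← hc] at h1
      exact (Submodule.smul_mem_iff_of_isUnit _ c.isUnit).1 h1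
  exact key m (h.mono (by omega) hm)

theorem iSup_eig (h : IsTriangular Fil E) : ⨆ n, eig E n = ⊤ := by
  refine eq_top_iff.2 fun x _ => ?_
  obtain ⟨n, hn⟩ := h.exhaustive x
  exact (iSup_mono fun m => iSup_le fun _ => le_rfl :
    (⨆ m, ⨆ (_ : m < n), eig E m) ≤ ⨆ m, eig E m) (h.le_iSup_eig n hn)

theorem isInternal (h : IsTriangular Fil E) : DirectSum.IsInternal (eig E) :=
  DirectSum.isInternal_submodule_of_iSupIndep_of_iSup_eq_top (iSupIndep_eig E) h.iSup_eig

theorem map_mem_of_eig (h : IsTriangular Fil E) (f : X →ₗ[k] Z) {S : Submodule k Z}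
    (hf : ∀ n, ∀ x ∈ eig E n, f x ∈ S) (x : X) : f x ∈ S :=
  (iSup_le hf : ⨆ n, eig E n ≤ S.comap f) (h.iSup_eig ▸ Submodule.mem_top)

theorem hom_ext (h : IsTriangular Fil E) {f g : X →ₗ[k] Z}
    (hfg : ∀ n, ∀ x ∈ eig E n, f x = g x) : f = g :=
  LinearMap.ext fun x => sub_eq_zero.1 <| (Submodule.mem_bot k).1 <|
    h.map_mem_of_eig (f - g) (fun n x hx => by simp [hfg n x hx]) x

/-- Two endomorphisms that are triangular for the same filtration are intertwined by a map that is
the identity on the associated graded module. -/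
theorem exists_intertwiner (h : IsTriangular Fil E) (h₀ : IsTriangular Fil E₀) :
    ∃ F : X →ₗ[k] X, ∀ n, ∀ x ∈ eig E n, F x ∈ eig E₀ n ∧ F x - x ∈ Fil n := by
  let _ := h.isInternal.chooseDecomposition
  have hP : ∀ n : ℕ, ∃ P : X →ₗ[k] X, ∀ x, P x ∈ eig E₀ n ∧ (x ∈ Fil (n + 1) → P x - x ∈ Fil n) := by
    intro n
    let _ := h₀.isInternal.chooseDecomposition
    -- The projection onto the `n`-eigenspace of `E₀`.
    let P : X →ₗ[k] X := (eig E₀ n).subtype ∘ₗ DirectSum.component k ℕ _ n ∘ₗ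
      (DirectSum.decomposeLinearEquiv (eig E₀)).toLinearMap
    have hd : ∀ y, P y = (DirectSum.decompose (eig E₀) y n : X) := fun y => rfl
    refine ⟨P, fun x => ⟨Subtype.property _, fun hx => ?_⟩⟩
    -- `Fil (n + 1)` is contained in the sum of the `E₀`-eigenspaces with `m ≤ n`. There `P` fixes
    -- the one with `m = n` and kills the others, which lie in `Fil n`.
    refine map_mem_of_mem_iSup_lt (P - LinearMap.id) (h₀.le_iSup_eig _ hx) fun m hm y hy => ?_
    rw [LinearMap.sub_apply, hd, LinearMap.id_apply]
    rcases (Nat.lt_succ_iff.1 hm).eq_or_lt with rfl | hm'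
    · rw [DirectSum.decompose_of_mem_same _ hy, sub_self]
      exact zero_mem _
    · rw [DirectSum.decompose_of_mem_ne _ hy hm'.ne, zero_sub]
      exact neg_mem (h.mono hm' (h₀.eig_le m hy))
  choose P hP using hP
  refine ⟨DirectSum.toModule k ℕ X (fun n => P n ∘ₗ (eig E n).subtype) ∘ₗ
    (DirectSum.decomposeLinearEquiv (eig E)).toLinearMap, fun n x hx => ?_⟩
  have hF : (DirectSum.toModule k ℕ X (fun n => P n ∘ₗ (eig E n).subtype) ∘ₗ
      (DirectSum.decomposeLinearEquiv (eig E)).toLinearMap) x = P n x := by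
    rw [LinearMap.comp_apply, LinearEquiv.coe_coe, DirectSum.decomposeLinearEquiv_apply,
      DirectSum.decompose_of_mem _ hx, ← DirectSum.lof_eq_of k, DirectSum.toModule_lof]
    rfl
  rw [hF]
  exact ⟨(hP n x).1, (hP n x).2 (h.eig_le n hx)⟩

/-! ### Bijectivity and naturality of the intertwiner -/

section Intertwiner

variable {F : X →ₗ[k] X} (h : IsTriangular Fil E) (h₀ : IsTriangular Fil E₀)
  (hF : ∀ n, ∀ x ∈ eig E n, F x ∈ eig E₀ n ∧ F x - x ∈ Fil n)

include h hF in
theorem intertwiner_sub_mem {n : ℕ} {x : X} (hx : x ∈ Fil (n + 1)) : F x - x ∈ Fil n :=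
  map_mem_of_mem_iSup_lt (F - LinearMap.id) (h.le_iSup_eig _ hx)
    fun m hm y hy => h.mono (Nat.lt_succ_iff.1 hm) (hF m y hy).2

-- `F` is the identity modulo the next lower step of an exhaustive filtration that starts at zero.
include h hF in
theorem intertwiner_bijective : Function.Bijective F := by
  constructor
  · rw [← LinearMap.ker_eq_bot, LinearMap.ker_eq_bot']
    intro x hx
    obtain ⟨n, hn⟩ := h.exhaustive x
    induction n with
    | zero => rwa [h.zero, Submodule.mem_bot] at hn
    | succ n ih =>
      refine ih ?_
      simpa [hx] using neg_mem (intertwiner_sub_mem h hF hn)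
  · intro y
    obtain ⟨n, hn⟩ := h.exhaustive y
    induction n generalizing y with
    | zero =>
      rw [h.zero, Submodule.mem_bot] at hn
      exact ⟨0, by simp [hn]⟩
    | succ n ih =>
      obtain ⟨z, hz⟩ := ih _ (intertwiner_sub_mem h hF hn)
      exact ⟨y - z, by rw [map_sub, hz]; abel⟩

-- On an `n`-eigenvector `x`, both `f (F x)` and `f x` have eigenvalue `n`. Since `F x - x` is a sum
-- of `E₀`-eigenvectors below `n`, so is its image for `T`, and rigidity applies. This puts the
-- trivialization over `B`.
include h h₀ hF in
theorem comp_intertwiner {f : X →ₗ[k] Z} {T : Module.End k Z} (hf : f ∘ₗ E = T ∘ₗ f)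
    (hf₀ : f ∘ₗ E₀ = T ∘ₗ f) : f ∘ₗ F = f := by
  refine h.hom_ext fun n x hx => ?_
  rw [← sub_eq_zero, LinearMap.comp_apply]
  refine eq_zero_of_mem_eig (T := T) (n := n)
    (sub_mem (map_mem_eig hf₀ (hF n x hx).1) (map_mem_eig hf hx)) ?_
  rw [← map_sub]
  exact map_mem_of_mem_iSup_lt f (h₀.le_iSup_eig _ (hF n x hx).2)
    fun m hm y hy => mem_iSup_eig_of_lt hm (map_mem_eig hf₀ hy)

include h h₀ hF in
theorem intertwiner_comm {f : X →ₗ[k] X} (hf : f ∘ₗ E = E ∘ₗ f) (hf₀ : f ∘ₗ E₀ = E₀ ∘ₗ f) :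
    f ∘ₗ F = F ∘ₗ f := by
  refine h.hom_ext fun n x hx => ?_
  have hfx := map_mem_eig hf hx
  rw [← sub_eq_zero, LinearMap.comp_apply, LinearMap.comp_apply]
  refine eq_zero_of_mem_eig (T := E₀) (n := n)
    (sub_mem (map_mem_eig hf₀ (hF n x hx).1) (hF n _ hfx).1) ?_
  have h1 : f (F x - x) ∈ ⨆ m, ⨆ (_ : m < n), eig E₀ m :=
    map_mem_of_mem_iSup_lt f (h₀.le_iSup_eig _ (hF n x hx).2)
      fun m hm y hy => mem_iSup_eig_of_lt hm (map_mem_eig hf₀ hy)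
  have h2 := h₀.le_iSup_eig _ (hF n _ hfx).2
  have h3 : f (F x) - F (f x) = f (F x - x) - (F (f x) - f x) := by
    rw [map_sub]; abel
  rw [h3]
  exact sub_mem h1 h2

-- The tensors of eigenvectors already span the tensor square, so no eigenspace of `tensorSum E` can
-- be larger than the part they span.
include h in
theorem eig_tensorSum_le (n : ℕ) : eig (tensorSum E) n ≤
    Submodule.span k {t | ∃ i j, i + j = n ∧ ∃ a ∈ eig E i, ∃ b ∈ eig E j, a ⊗ₜ b = t} := by
  refine eig_le_of_iSup_eq_top (P := fun n => Submodule.span k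
    {t | ∃ i j, i + j = n ∧ ∃ a ∈ eig E i, ∃ b ∈ eig E j, a ⊗ₜ b = t}) (fun n => ?_) ?_ n
  · rw [Submodule.span_le]
    rintro _ ⟨i, j, rfl, a, ha, b, hb, rfl⟩
    exact tmul_mem_eig_tensorSum ha hb
  · refine eq_top_iff.2 fun t _ => ?_
    induction t using TensorProduct.induction_on with
    | zero => exact zero_mem _
    | add x y hx hy => exact add_mem (hx trivial) (hy trivial)
    | tmul a b =>
      refine h.map_mem_of_eig ((TensorProduct.mk k X X).flip b) (fun i a ha => ?_) a
      refine h.map_mem_of_eig (TensorProduct.mk k X X a) (fun j b hb => ?_) b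
      exact Submodule.mem_iSup_of_mem (i + j)
        (Submodule.subset_span ⟨i, j, rfl, a, ha, b, hb, rfl⟩)

-- The rigidity argument on the tensor square: a degree 0 coderivation is intertwined by `Δ` with
-- its `tensorSum`, and `F ⊗ F - 1` lowers eigenvalues because `F - 1` does.
include h h₀ hF in
theorem intertwiner_map_comul {f : X →ₗ[k] X ⊗[k] X} (hf : f ∘ₗ E = tensorSum E ∘ₗ f)
    (hf₀ : f ∘ₗ E₀ = tensorSum E₀ ∘ₗ f) : f ∘ₗ F = TensorProduct.map F F ∘ₗ f := by
  refine h.hom_ext fun n x hx => ?_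
  have hfx := h.eig_tensorSum_le n (map_mem_eig hf hx)
  have key : ∀ t ∈ Submodule.span k
      {t | ∃ i j, i + j = n ∧ ∃ a ∈ eig E i, ∃ b ∈ eig E j, a ⊗ₜ[k] b = t},
      TensorProduct.map F F t ∈ eig (tensorSum E₀) n ∧
        TensorProduct.map F F t - t ∈ ⨆ m, ⨆ (_ : m < n), eig (tensorSum E₀) m := by
    intro t ht
    induction ht using Submodule.span_induction with
    | mem t ht =>
      obtain ⟨i, j, rfl, a, ha, b, hb, rfl⟩ := ht
      refine ⟨tmul_mem_eig_tensorSum (hF i a ha).1 (hF j b hb).1, ?_⟩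
      -- Telescoping, so that each summand contains one factor `F - 1`.
      have h1 : TensorProduct.map F F (a ⊗ₜ[k] b) - a ⊗ₜ b =
          (F a - a) ⊗ₜ F b + a ⊗ₜ (F b - b) := by
        rw [TensorProduct.map_tmul, TensorProduct.sub_tmul, TensorProduct.tmul_sub]
        abel
      rw [h1]
      exact add_mem
        (tmul_mem_iSup_eig_tensorSum (by omega) (h₀.le_iSup_eig _ (hF i a ha).2)
          (mem_iSup_eig_of_lt j.lt_succ_self (hF j b hb).1))
        (tmul_mem_iSup_eig_tensorSum (by omega) (h₀.le_iSup_eig _ (h.eig_le i ha))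
          (h₀.le_iSup_eig _ (hF j b hb).2))
    | zero => simp
    | add s t _ _ hs ht =>
      rw [map_add, add_sub_add_comm]
      exact ⟨add_mem hs.1 ht.1, add_mem hs.2 ht.2⟩
    | smul c t _ ht =>
      rw [map_smul, ← smul_sub]
      exact ⟨Submodule.smul_mem _ _ ht.1, Submodule.smul_mem _ _ ht.2⟩
  rw [← sub_eq_zero, LinearMap.comp_apply, LinearMap.comp_apply]
  refine eq_zero_of_mem_eig (T := tensorSum E₀) (n := n)
    (sub_mem (map_mem_eig hf₀ (hF n x hx).1) (key _ hfx).1) ?_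
  have h1 : f (F x - x) ∈ ⨆ m, ⨆ (_ : m < n), eig (tensorSum E₀) m :=
    map_mem_of_mem_iSup_lt f (h₀.le_iSup_eig _ (hF n x hx).2)
      fun m hm y hy => mem_iSup_eig_of_lt hm (map_mem_eig hf₀ hy)
  have h3 : f (F x) - TensorProduct.map F F (f x) =
      f (F x - x) - (TensorProduct.map F F (f x) - f x) := by
    rw [map_sub]; abel
  rw [h3]
  exact sub_mem h1 (key _ hfx).2

end Intertwiner

end IsTriangular

end Eigen

end

section

variable {k : Type v} [CommRing k]

namespace Sym

variable {V W : GrMod.{u} k}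

/-! ### The operators `ofTaylor` -/

theorem ofTaylor_one (q : Sym W →ₗ[k] W) : ofTaylor W q 1 = ι W (q 1) := by
  simp [ofTaylor, comul_one]

theorem ofTaylor_add (q r : Sym W →ₗ[k] W) :
    ofTaylor W (q + r) = ofTaylor W q + ofTaylor W r := by
  simp only [ofTaylor, LinearMap.comp_add, TensorProduct.map_add_left, LinearMap.add_comp]

theorem hasDegree_comp_mulι {i j : ℤ} {q : Sym W →ₗ[k] W} (hq : GrMod.HasDegree (gr W) W.gr j q)
    {w : W} (hw : w ∈ W.gr i) : GrMod.HasDegree (gr W) W.gr (i + j) (q ∘ₗ mulι W w) :=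
  hq.comp (hasDegree_mulι hw) rfl

/-- The first letter either is fed to `q` or stays outside it. The first case replaces `q` by `q ∘ₗ
mulι W w`, of another degree, so inductions over words generalise `q` and `j`. -/
theorem ofTaylor_ι_mul {i j : ℤ} {q : Sym W →ₗ[k] W} (hq : GrMod.HasDegree (gr W) W.gr j q)
    {w : W} (hw : w ∈ W.gr i) (x : Sym W) :
    ofTaylor W q (ι W w * x) =
      ofTaylor W (q ∘ₗ mulι W w) x + sgn k (i * j) • (ι W w * ofTaylor W q x) := by
  have h : LinearMap.mul' k (Sym W) ∘ₗ TensorProduct.map (ι W ∘ₗ q) LinearMap.id ∘ₗ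
      TensorProduct.map (GrMod.koszul (gr W) i) (mulι W w) =
        sgn k (i * j) • (mulι W w ∘ₗ LinearMap.mul' k (Sym W) ∘ₗ
          TensorProduct.map (ι W ∘ₗ q) LinearMap.id) := by
    refine TensorProduct.ext' fun a b => ?_
    induction a using DirectSum.Decomposition.inductionOn (gr W) with
    | zero => simp
    | @homogeneous d m =>
      obtain ⟨a, ha⟩ := m
      simp only [LinearMap.comp_apply, TensorProduct.map_tmul, LinearMap.smul_apply,
        LinearMap.mul'_apply, LinearMap.id_apply, mulι_apply]
      rw [ι_mul_of_mem hw (hq d a ha), smul_smul, GrMod.koszul_apply_of_mem (gr W) i ha, map_smul,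
        map_smul, smul_mul_assoc]
      congr 1
      rw [mul_add, sgn_add, mul_left_comm, sgn_mul_self, mul_one]
    | add x y hx hy =>
      rw [TensorProduct.add_tmul, map_add, map_add, hx, hy]
  simp only [ofTaylor, LinearMap.comp_apply]
  rw [comul_ι_mul hw, map_add, map_add, TensorProduct.map_map]
  congr 1
  exact LinearMap.congr_fun h (comul W x)

theorem counit_ofTaylor (q : Sym W →ₗ[k] W) (x : Sym W) : counit W (ofTaylor W q x) = 0 := by
  have h : (counit W).toLinearMap ∘ₗ LinearMap.mul' k (Sym W) ∘ₗ
      TensorProduct.map (ι W ∘ₗ q) LinearMap.id = 0 :=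
    TensorProduct.ext' fun a b => by simp [counit_ι_mul]
  exact LinearMap.congr_fun h (comul W x)

theorem pr_ofTaylor {j : ℤ} {q : Sym W →ₗ[k] W} (hq : GrMod.HasDegree (gr W) W.gr j q)
    (x : Sym W) : pr W (ofTaylor W q x) = q x := by
  induction x using induction generalizing j q with
  | one => rw [ofTaylor_one, pr_ι]
  | mul i w hw x ih =>
    rw [ofTaylor_ι_mul hq hw, map_add, ih (hasDegree_comp_mulι hq hw), _root_.map_smul, pr_ι_mul,
      counit_ofTaylor, zero_smul, smul_zero, add_zero]
    rfl
  | add x y hx hy => rw [map_add, map_add, map_add, hx hq, hy hq]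
  | smul c x hx => rw [_root_.map_smul, _root_.map_smul, _root_.map_smul, hx hq]

theorem hasDegree_ofTaylor {j : ℤ} {q : Sym W →ₗ[k] W} (hq : GrMod.HasDegree (gr W) W.gr j q) :
    GrMod.HasDegree (gr W) (gr W) j (ofTaylor W q) := by
  intro d x hx
  induction hx using Submodule.span_induction with
  | mem x hx =>
    obtain ⟨l, rfl, rfl⟩ := hx
    induction l generalizing j q with
    | nil =>
      simp only [List.map_nil, List.prod_nil, ofTaylor_one]
      exact ι_mem_gr (hq _ _ SetLike.GradedOne.one_mem)
    | cons a l ih =>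
      simp only [List.map_cons, List.prod_cons, List.sum_cons, ofTaylor_ι_mul hq a.2.2]
      refine add_mem ?_ (Submodule.smul_mem _ _ ?_)
      · have h := ih (hasDegree_comp_mulι hq a.2.2)
        rwa [← add_assoc, add_comm _ a.1] at h
      · rw [add_assoc]
        exact mem_gr_mul (ι_mem_gr a.2.2) (ih hq)
  | zero => simp
  | add x y _ _ hx hy => rw [map_add]; exact add_mem hx hy
  | smul c x _ hx => rw [_root_.map_smul]; exact Submodule.smul_mem _ _ hx

/-- `R` is a coderivation of degree `j` along the coalgebra map `G`. -/
def IsCoderivationAlong (G R : Sym V →ₗ[k] Sym W) (j : ℤ) : Prop :=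
  comul W ∘ₗ R = (TensorProduct.map R G +
    TensorProduct.map (GrMod.koszul (gr W) j ∘ₗ G) R) ∘ₗ comul V

theorem comul_ofTaylor {j : ℤ} {q : Sym W →ₗ[k] W} (hq : GrMod.HasDegree (gr W) W.gr j q)
    (x : Sym W) : comul W (ofTaylor W q x) =
      TensorProduct.map (ofTaylor W q) LinearMap.id (comul W x) +
        TensorProduct.map (GrMod.koszul (gr W) j) (ofTaylor W q) (comul W x) := by
  induction x using induction generalizing j q with
  | one => simp [ofTaylor_one, comul_one, comul_ι, koszul_one]
  | mul i w hw x ih =>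
    -- The inductive step as an identity of operators on `S(W) ⊗ S(W)`, to be evaluated at `Δ x`. It
    -- can be tested on pure tensors, unlike the statement itself.
    have hop : TensorProduct.map (ofTaylor W (q ∘ₗ mulι W w)) LinearMap.id +
          TensorProduct.map (GrMod.koszul (gr W) (i + j)) (ofTaylor W (q ∘ₗ mulι W w)) +
        sgn k (i * j) • ((TensorProduct.map (mulι W w) LinearMap.id +
          TensorProduct.map (GrMod.koszul (gr W) i) (mulι W w)) ∘ₗ
            (TensorProduct.map (ofTaylor W q) LinearMap.id +
            TensorProduct.map (GrMod.koszul (gr W) j) (ofTaylor W q))) =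
        (TensorProduct.map (ofTaylor W q) LinearMap.id +
          TensorProduct.map (GrMod.koszul (gr W) j) (ofTaylor W q)) ∘ₗ
          (TensorProduct.map (mulι W w) LinearMap.id +
            TensorProduct.map (GrMod.koszul (gr W) i) (mulι W w)) := by
      refine TensorProduct.ext' fun a b => ?_
      simp only [map_add, LinearMap.add_apply, LinearMap.smul_apply, LinearMap.comp_apply,
        TensorProduct.map_tmul, LinearMap.id_apply, mulι_apply,
        ofTaylor_ι_mul hq hw, (hasDegree_ofTaylor hq).koszul_map, koszul_ι_mul j hw,
        GrMod.koszul_koszul, TensorProduct.add_tmul, TensorProduct.tmul_add,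
        ← TensorProduct.smul_tmul', TensorProduct.tmul_smul, smul_add, smul_smul,
        sgn_mul_self, one_smul, mul_comm j i, add_comm j i]
      abel
    rw [ofTaylor_ι_mul hq hw, map_add, ih (hasDegree_comp_mulι hq hw), _root_.map_smul,
      comul_ι_mul hw, ih hq, comul_ι_mul hw]
    exact LinearMap.congr_fun hop (comul W x)
  | add x y hx hy =>
    simp only [map_add, hx hq, hy hq]
    abel
  | smul c x hx => simp only [_root_.map_smul, hx hq, smul_add]

theorem isVectorField_ofTaylor {j : ℤ} {q : Sym W →ₗ[k] W}
    (hq : GrMod.HasDegree (gr W) W.gr j q) : IsVectorField W j (ofTaylor W q) where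
  degree := hasDegree_ofTaylor hq
  coderivation := LinearMap.ext fun x => comul_ofTaylor hq x

/-- A constant vector field feeds only the empty subword to its coefficient; this is the counit
axiom. -/
theorem ofTaylor_counit_smulRight (w : W) (x : Sym W) :
    ofTaylor W ((counit W).toLinearMap.smulRight w) x = ι W w * x := by
  have h : LinearMap.mul' k (Sym W) ∘ₗ
      TensorProduct.map (ι W ∘ₗ (counit W).toLinearMap.smulRight w) LinearMap.id =
      mulι W w ∘ₗ (TensorProduct.lid k (Sym W)).toLinearMap ∘ₗ
        TensorProduct.map (counit W).toLinearMap LinearMap.id :=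
    TensorProduct.ext' fun a b => by simp
  have h1 := LinearMap.congr_fun h (comul W x)
  simp only [LinearMap.comp_apply, map_counit_comul] at h1
  simpa [ofTaylor] using h1

theorem comp_pr_comp_mulι (f : W →ₗ[k] W) (w : W) :
    (f ∘ₗ pr W) ∘ₗ mulι W w = (counit W).toLinearMap.smulRight (f w) :=
  LinearMap.ext fun x => by simp [pr_ι_mul]

theorem ofTaylor_comp_pr_ι_mul {i j : ℤ} {f : W →ₗ[k] W} (hf : GrMod.HasDegree W.gr W.gr j f)
    {w : W} (hw : w ∈ W.gr i) (x : Sym W) :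
    ofTaylor W (f ∘ₗ pr W) (ι W w * x) =
      ι W (f w) * x + sgn k (i * j) • (ι W w * ofTaylor W (f ∘ₗ pr W) x) := by
  rw [ofTaylor_ι_mul (hf.comp (hasDegree_pr W) (zero_add j)) hw, comp_pr_comp_mulι,
    ofTaylor_counit_smulRight]

/-! ### Filtrations by the number of letters -/

/-- `IsWord K n x` says that `x` is a product of homogeneous elements of `W`, of which all but `n`
belong to `K`. -/
inductive IsWord (K : Submodule k W) : ℕ → Sym W → Prop
  | one : IsWord K 0 1
  | small {n : ℕ} {x : Sym W} {i : ℤ} {w : W} (hw : w ∈ W.gr i) (hK : w ∈ K) (hx : IsWord K n x) :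
      IsWord K n (ι W w * x)
  | big {n : ℕ} {x : Sym W} {i : ℤ} {w : W} (hw : w ∈ W.gr i) (hx : IsWord K n x) :
      IsWord K (n + 1) (ι W w * x)

/-- The span of the products of homogeneous elements of which less than `n` are outside `K`. -/
def fil (K : Submodule k W) (n : ℕ) : Submodule k (Sym W) :=
  Submodule.span k {x | ∃ m < n, IsWord K m x}

variable {K : Submodule k W}

theorem IsWord.mem_fil {m n : ℕ} {x : Sym W} (hx : IsWord K m x) (h : m < n) : x ∈ fil K n :=
  Submodule.subset_span ⟨m, h, hx⟩

theorem fil_mono : Monotone (fil K) := fun _ _ h =>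
  Submodule.span_mono fun _ ⟨l, hl, hx⟩ => ⟨l, hl.trans_le h, hx⟩

theorem fil_zero : fil K 0 = ⊥ := by simp [fil]

theorem map_mem_of_mem_fil {Z : Type*} [AddCommGroup Z] [Module k Z] (f : Sym W →ₗ[k] Z)
    {S : Submodule k Z} {n : ℕ} (h : ∀ m < n, ∀ x, IsWord K m x → f x ∈ S) {x : Sym W}
    (hx : x ∈ fil K n) : f x ∈ S :=
  (Submodule.span_le.2 (by rintro x ⟨m, hm, hx⟩; exact h m hm x hx) : fil K n ≤ S.comap f) hx

theorem ι_mul_mem_fil {i : ℤ} {w : W} (hw : w ∈ W.gr i) {n : ℕ} {x : Sym W} (hx : x ∈ fil K n) :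
    ι W w * x ∈ fil K (n + 1) :=
  map_mem_of_mem_fil (mulι W w) (fun _ hm _ hx => (IsWord.big hw hx).mem_fil (by omega)) hx

theorem ι_mul_mem_fil_of_mem {i : ℤ} {w : W} (hw : w ∈ W.gr i) (hK : w ∈ K) {n : ℕ} {x : Sym W}
    (hx : x ∈ fil K n) : ι W w * x ∈ fil K n :=
  map_mem_of_mem_fil (mulι W w) (fun _ hm _ hx => (IsWord.small hw hK hx).mem_fil hm) hx

variable (K) in
theorem exists_mem_fil (x : Sym W) : ∃ n, x ∈ fil K n := by
  induction x using induction with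
  | one => exact ⟨1, IsWord.one.mem_fil zero_lt_one⟩
  | mul i w hw x ih =>
    obtain ⟨n, hn⟩ := ih
    exact ⟨n + 1, ι_mul_mem_fil hw hn⟩
  | add x y hx hy =>
    obtain ⟨m, hm⟩ := hx
    obtain ⟨n, hn⟩ := hy
    exact ⟨max m n, add_mem (fil_mono (le_max_left m n) hm) (fil_mono (le_max_right m n) hn)⟩
  | smul c x hx =>
    obtain ⟨n, hn⟩ := hx
    exact ⟨n, Submodule.smul_mem _ _ hn⟩

/-- It suffices to test words. The index of `IsWord` is only an upper bound for the number of
letters outside `K`, since `big` accepts letters of `K` too. -/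
theorem isTriangular_fil [Algebra ℚ k] {E : Module.End k (Sym W)}
    (h : ∀ n x, IsWord K n x → E x - (n : k) • x ∈ fil K n) : IsTriangular (fil K) E where
  mono := fil_mono
  zero := fil_zero
  exhaustive := exists_mem_fil K
  lower n x hx := by
    refine map_mem_of_mem_fil (E - (n : k) • LinearMap.id) (fun m hm y hy => ?_) hx
    have h1 : (E - (n : k) • LinearMap.id : Module.End k (Sym W)) y =
        (E y - (m : k) • y) + ((m : k) - n) • y := by
      simp [sub_smul]
    rw [h1]
    refine add_mem (fil_mono (Nat.lt_succ_iff.1 hm) (h m y hy)) ?_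
    rcases (Nat.lt_succ_iff.1 hm).eq_or_lt with rfl | hm'
    · simp
    · exact Submodule.smul_mem _ _ (hy.mem_fil hm')

/-! ### Primitive elements and uniqueness of coderivations -/

-- With coefficient `pr W` the vector field is the Euler field, multiplying a word of `n` letters by
-- `n`. For `K = ⊥` the filtration is by word length, and a word with a `small` letter is zero.
variable (W) in
theorem isTriangular_euler [Algebra ℚ k] :
    IsTriangular (fil (⊥ : Submodule k W)) (ofTaylor W (pr W)) := by
  refine isTriangular_fil fun n x hx => ?_
  have h : ∀ {i : ℤ} {w : W}, w ∈ W.gr i → ∀ x, ofTaylor W (pr W) (ι W w * x) =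
      ι W w * x + ι W w * ofTaylor W (pr W) x := fun {i w} hw x => by
    have h1 := ofTaylor_comp_pr_ι_mul (j := 0) (f := LinearMap.id)
      (fun i x hx => by rwa [add_zero]) hw x
    rwa [LinearMap.id_comp, mul_zero, sgn_zero, one_smul] at h1
  have h0 : ofTaylor W (pr W) x = (n : k) • x := by
    induction hx with
    | one => rw [ofTaylor_one, pr_one, map_zero, Nat.cast_zero, zero_smul]
    | small hw hK hx ih =>
      rw [(Submodule.mem_bot k).1 hK, map_zero, zero_mul, map_zero, smul_zero]
    | big hw hx ih => rw [h hw, ih, Nat.cast_succ, add_smul, one_smul, mul_smul_comm, add_comm]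
  rw [h0, sub_self]
  exact zero_mem _

/-- The Euler field sends both `y` and its linear part to that linear part, so their difference has
eigenvalue 0 and is a scalar. The counit shows that this scalar is 0. -/
theorem eq_ι_pr_of_primitive [Algebra ℚ k] {y : Sym W} (hy : comul W y = y ⊗ₜ 1 + 1 ⊗ₜ y) :
    y = ι W (pr W y) := by
  have h1 : ofTaylor W (pr W) y = ι W (pr W y) := by
    simp [ofTaylor, hy]
  have h2 : ofTaylor W (pr W) (ι W (pr W y)) = ι W (pr W y) := by
    simp [ofTaylor, comul_ι]
  have h3 : y - ι W (pr W y) ∈ eig (ofTaylor W (pr W)) 0 := by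
    rw [mem_eig, map_sub, h1, h2, sub_self, Nat.cast_zero, zero_smul]
  have h4 : counit W y = 0 := by
    have h := congrArg (LinearMap.mul' k k ∘ₗ LinearMap.lTensor k (counit W).toLinearMap)
      (map_counit_comul W y)
    rw [hy] at h
    simpa using h
  have h5 : y - ι W (pr W y) ∈ Submodule.span k {(1 : Sym W)} :=
    map_mem_of_mem_fil LinearMap.id (fun m hm x hx => by
      induction hx with
      | one => exact Submodule.mem_span_singleton_self _
      | small hw hK hx ih => simp [(Submodule.mem_bot k).1 hK]
      | big hw hx ih => omega) ((isTriangular_euler W).eig_le 0 h3)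
  obtain ⟨c, hc⟩ := Submodule.mem_span_singleton.1 h5
  have h6 := congrArg (counit W) hc
  rw [_root_.map_smul, map_one, map_sub, h4, ← mul_one (ι W (pr W y)), counit_ι_mul, sub_zero,
    smul_eq_mul, mul_one] at h6
  rw [h6, zero_smul] at hc
  exact sub_eq_zero.1 hc.symm

theorem koszul_mem_fil (j : ℤ) {n : ℕ} {x : Sym W} (hx : x ∈ fil K n) :
    GrMod.koszul (gr W) j x ∈ fil K n := by
  refine map_mem_of_mem_fil (GrMod.koszul (gr W) j) (fun m hm y hy => ?_) hx
  refine (?_ : GrMod.koszul (gr W) j y ∈ fil K (m + 1)) |> fun h => fil_mono hm h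
  clear hm hx
  induction hy with
  | one => rw [koszul_one]; exact IsWord.one.mem_fil zero_lt_one
  | small hw hK hx ih =>
    rw [koszul_ι_mul j hw]
    exact Submodule.smul_mem _ _ (ι_mul_mem_fil_of_mem hw hK ih)
  | big hw hx ih =>
    rw [koszul_ι_mul j hw]
    exact Submodule.smul_mem _ _ (ι_mul_mem_fil hw ih)

section

variable {Y Z : Type*} [AddCommGroup Y] [Module k Y] [AddCommGroup Z] [Module k Z]

/-- In `Δ x` every right factor other than `x` itself is a shorter word, on which `φ` vanishes. -/
theorem map_comul_of_vanish_right {n : ℕ} {x : Sym W} (hx : IsWord (⊥ : Submodule k W) n x)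
    (g : Sym W →ₗ[k] Y) (φ : Sym W →ₗ[k] Z) (hφ : ∀ y ∈ fil (⊥ : Submodule k W) n, φ y = 0) :
    TensorProduct.map g φ (comul W x) = g 1 ⊗ₜ φ x := by
  induction hx generalizing g φ with
  | one => rw [comul_one, TensorProduct.map_tmul]
  | small hw hK hx ih => simp [(Submodule.mem_bot k).1 hK]
  | @big n x i w hw hx ih =>
    rw [comul_ι_mul hw, map_add, TensorProduct.map_map, TensorProduct.map_map, LinearMap.comp_id,
      ih _ _ fun y hy => hφ y (fil_mono n.le_succ hy), hφ x (hx.mem_fil n.lt_succ_self),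
      TensorProduct.tmul_zero, zero_add, ih _ (φ ∘ₗ mulι W w) fun y hy => hφ _ (ι_mul_mem_fil hw hy),
      LinearMap.comp_apply, koszul_one]
    rfl

theorem map_comul_of_vanish_left {n : ℕ} {x : Sym W} (hx : IsWord (⊥ : Submodule k W) n x)
    (g : Sym W →ₗ[k] Y) (φ : Sym W →ₗ[k] Z) (hφ : ∀ y ∈ fil (⊥ : Submodule k W) n, φ y = 0) :
    TensorProduct.map φ g (comul W x) = φ x ⊗ₜ g 1 := by
  induction hx generalizing g φ with
  | one => rw [comul_one, TensorProduct.map_tmul]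
  | small hw hK hx ih => simp [(Submodule.mem_bot k).1 hK]
  | @big n x i w hw hx ih =>
    rw [comul_ι_mul hw, map_add, TensorProduct.map_map, TensorProduct.map_map, LinearMap.comp_id,
      ih _ (φ ∘ₗ mulι W w) fun y hy => hφ _ (ι_mul_mem_fil hw hy),
      ih _ _ fun y hy => (hφ _ (koszul_mem_fil i (fil_mono n.le_succ hy)) :
        (φ ∘ₗ GrMod.koszul (gr W) i) y = 0), LinearMap.comp_apply,
      LinearMap.comp_apply, hφ _ (koszul_mem_fil i (hx.mem_fil n.lt_succ_self)),
      TensorProduct.zero_tmul, add_zero]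
    rfl

end

/-- Induct on word length: if `R` kills shorter words, the coderivation identity makes `R y`
primitive, hence equal to its linear part, which is 0. Identities between vector fields can
therefore be checked after `pr`. -/
theorem IsCoderivationAlong.eq_zero [Algebra ℚ k] {G R : Sym V →ₗ[k] Sym W} {j : ℤ}
    (hR : IsCoderivationAlong G R j) (hG : G 1 = 1) (h : ∀ x, pr W (R x) = 0) : R = 0 := by
  have key : ∀ n, ∀ x ∈ fil (⊥ : Submodule k V) n, R x = 0 := by
    intro n
    induction n with
    | zero =>
      intro x hx
      rw [fil_zero, Submodule.mem_bot] at hx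
      rw [hx, map_zero]
    | succ n ih =>
      intro x hx
      rw [← Submodule.mem_bot k]
      refine map_mem_of_mem_fil R (fun m hm y hy => ?_) hx
      have ih' : ∀ z ∈ fil (⊥ : Submodule k V) m, R z = 0 :=
        fun z hz => ih z (fil_mono (Nat.lt_succ_iff.1 hm) hz)
      have hp : comul W (R y) = R y ⊗ₜ 1 + 1 ⊗ₜ R y := by
        have h1 := LinearMap.congr_fun hR y
        simp only [LinearMap.comp_apply, LinearMap.add_apply] at h1
        rw [h1, map_comul_of_vanish_left hy _ _ ih', map_comul_of_vanish_right hy _ _ ih',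
          LinearMap.comp_apply, hG, koszul_one]
      rw [Submodule.mem_bot, eq_ι_pr_of_primitive hp, h, map_zero]
  refine LinearMap.ext fun x => ?_
  obtain ⟨n, hn⟩ := exists_mem_fil ⊥ x
  exact key n x hn

theorem IsCoderivationAlong.sub {G R S : Sym V →ₗ[k] Sym W} {j : ℤ}
    (hR : IsCoderivationAlong G R j) (hS : IsCoderivationAlong G S j) :
    IsCoderivationAlong G (R - S) j := by
  unfold IsCoderivationAlong at *
  have h : TensorProduct.map (R - S) G + TensorProduct.map (GrMod.koszul (gr W) j ∘ₗ G) (R - S) =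
      (TensorProduct.map R G + TensorProduct.map (GrMod.koszul (gr W) j ∘ₗ G) R) -
        (TensorProduct.map S G + TensorProduct.map (GrMod.koszul (gr W) j ∘ₗ G) S) :=
    TensorProduct.ext' fun a b => by
      simp only [LinearMap.add_apply, LinearMap.sub_apply, TensorProduct.map_tmul,
        TensorProduct.sub_tmul, TensorProduct.tmul_sub]
      abel
  rw [LinearMap.comp_sub, hR, hS, h, LinearMap.sub_comp]

theorem IsCoderivationAlong.ext [Algebra ℚ k] {G R S : Sym V →ₗ[k] Sym W} {j : ℤ}
    (hR : IsCoderivationAlong G R j) (hS : IsCoderivationAlong G S j) (hG : G 1 = 1)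
    (h : ∀ x, pr W (R x) = pr W (S x)) : R = S :=
  sub_eq_zero.1 <| (hR.sub hS).eq_zero hG fun x => by
    rw [LinearMap.sub_apply, map_sub, h, sub_self]

theorem IsVectorField.isCoderivationAlong {j : ℤ} {Q : Sym W →ₗ[k] Sym W}
    (hQ : IsVectorField W j Q) : IsCoderivationAlong LinearMap.id Q j := hQ.coderivation

/-- Together with `map_comp`, this makes the relation `Q' ∘ G = G ∘ Q` testable on Taylor
coefficients. -/
theorem IsVectorField.comp_map {j : ℤ} {Q : Sym W →ₗ[k] Sym W} (hQ : IsVectorField W j Q)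
    {G : Sym V →ₗ[k] Sym W} (hG : comul W ∘ₗ G = TensorProduct.map G G ∘ₗ comul V) :
    IsCoderivationAlong G (Q ∘ₗ G) j := by
  unfold IsCoderivationAlong
  rw [← LinearMap.comp_assoc, hQ.coderivation, LinearMap.comp_assoc, hG, ← LinearMap.comp_assoc,
    LinearMap.add_comp, ← TensorProduct.map_comp, ← TensorProduct.map_comp, LinearMap.id_comp]

theorem IsVectorField.map_comp {j : ℤ} {Q : Sym V →ₗ[k] Sym V} (hQ : IsVectorField V j Q)
    {G : Sym V →ₗ[k] Sym W} (hG : comul W ∘ₗ G = TensorProduct.map G G ∘ₗ comul V)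
    (hd : GrMod.HasDegree (gr V) (gr W) 0 G) :
    IsCoderivationAlong G (G ∘ₗ Q) j := by
  have h : GrMod.koszul (gr W) j ∘ₗ G = G ∘ₗ GrMod.koszul (gr V) j :=
    LinearMap.ext fun x => by
      simp [hd.koszul_map, sgn_zero]
  unfold IsCoderivationAlong
  rw [h, ← LinearMap.comp_assoc, hG, LinearMap.comp_assoc, hQ.coderivation, ← LinearMap.comp_assoc,
    LinearMap.comp_add, ← TensorProduct.map_comp, ← TensorProduct.map_comp, LinearMap.comp_id]

theorem IsVectorField.eq_ofTaylor [Algebra ℚ k] {j : ℤ} {Q : Sym W →ₗ[k] Sym W}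
    (hQ : IsVectorField W j Q) : Q = ofTaylor W (pr W ∘ₗ Q) := by
  have hq : GrMod.HasDegree (gr W) W.gr j (pr W ∘ₗ Q) :=
    (hasDegree_pr W).comp hQ.degree (add_zero j)
  exact hQ.isCoderivationAlong.ext (isVectorField_ofTaylor hq).isCoderivationAlong rfl fun x =>
    (pr_ofTaylor hq x).symm

/-- The commutator of two odd vector fields of opposite degrees. -/
theorem isVectorField_anticommutator {P Q : Sym W →ₗ[k] Sym W} (hP : IsVectorField W 1 P)
    (hQ : IsVectorField W (-1) Q) : IsVectorField W 0 (P ∘ₗ Q + Q ∘ₗ P) where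
  degree := (hP.degree.comp hQ.degree (by norm_num)).add (hQ.degree.comp hP.degree (by norm_num))
  coderivation := by
    have h : (TensorProduct.map P LinearMap.id + TensorProduct.map (GrMod.koszul (gr W) 1) P) ∘ₗ
        (TensorProduct.map Q LinearMap.id + TensorProduct.map (GrMod.koszul (gr W) (-1)) Q) +
        (TensorProduct.map Q LinearMap.id + TensorProduct.map (GrMod.koszul (gr W) (-1)) Q) ∘ₗ
        (TensorProduct.map P LinearMap.id + TensorProduct.map (GrMod.koszul (gr W) 1) P) =
        TensorProduct.map (P ∘ₗ Q + Q ∘ₗ P) LinearMap.id +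
          TensorProduct.map (GrMod.koszul (gr W) 0) (P ∘ₗ Q + Q ∘ₗ P) := by
      refine TensorProduct.ext' fun a b => ?_
      -- Parity signs square to 1; here via `koszul (-1) = koszul 1`.
      have h2 : GrMod.koszul (gr W) (1 + 1) a = a := by
        have h := GrMod.koszul_koszul (gr W) 1 (-1) a
        rwa [GrMod.koszul_neg, GrMod.koszul_koszul, add_neg_cancel, GrMod.koszul_zero] at h
      simp only [LinearMap.add_apply, map_add, TensorProduct.map_tmul, LinearMap.id_apply,
        GrMod.koszul_neg, LinearMap.comp_apply, hP.degree.koszul_map, hQ.degree.koszul_map,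
        TensorProduct.add_tmul, TensorProduct.tmul_add, one_mul, mul_one, sgn_neg, sgn_one,
        GrMod.koszul_koszul, h2, GrMod.koszul_zero, neg_smul, one_smul, TensorProduct.neg_tmul]
      abel
    rw [LinearMap.comp_add, ← LinearMap.comp_assoc, ← LinearMap.comp_assoc, hP.coderivation,
      hQ.coderivation, LinearMap.comp_assoc, LinearMap.comp_assoc, hP.coderivation,
      hQ.coderivation, ← LinearMap.comp_assoc, ← LinearMap.comp_assoc, ← LinearMap.add_comp, h]

theorem comul_comp_of_isVectorField_zero {E : Sym W →ₗ[k] Sym W} (hE : IsVectorField W 0 E) :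
    comul W ∘ₗ E = tensorSum E ∘ₗ comul W := by
  rw [hE.coderivation, GrMod.koszul_zero]
  rfl

/-! ### Vector fields that lower a filtration -/

theorem ι_mem_fil {i : ℤ} {w : W} (hw : w ∈ W.gr i) : ι W w ∈ fil K 2 := by
  simpa using (IsWord.big hw (IsWord.one (K := K))).mem_fil (n := 2) (by omega)

theorem ι_mem_fil_of_mem {i : ℤ} {w : W} (hw : w ∈ W.gr i) (hK : w ∈ K) : ι W w ∈ fil K 1 := by
  simpa using (IsWord.small hw hK IsWord.one).mem_fil (n := 1) (by omega)

/-- Each term replaces some letters by a single one, so the count of letters outside `K` grows by at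
most 1. -/
theorem ofTaylor_mem_fil {j : ℤ} {q : Sym W →ₗ[k] W} (hq : GrMod.HasDegree (gr W) W.gr j q)
    {n : ℕ} {x : Sym W} (hx : IsWord K n x) : ofTaylor W q x ∈ fil K (n + 2) := by
  induction hx generalizing j q with
  | one =>
    rw [ofTaylor_one]
    exact ι_mem_fil (hq _ _ SetLike.GradedOne.one_mem)
  | small hw hK hx ih =>
    rw [ofTaylor_ι_mul hq hw]
    exact add_mem (ih (hasDegree_comp_mulι hq hw))
      (Submodule.smul_mem _ _ (ι_mul_mem_fil_of_mem hw hK (ih hq)))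
  | big hw hx ih =>
    rw [ofTaylor_ι_mul hq hw]
    exact add_mem (fil_mono (by omega) (ih (hasDegree_comp_mulι hq hw)))
      (Submodule.smul_mem _ _ (ι_mul_mem_fil hw (ih hq)))

/-- A new letter outside `K` can arise only when `q` has consumed at least one such letter, so the
count does not grow. -/
theorem ofTaylor_mem_fil_succ {j : ℤ} {q : Sym W →ₗ[k] W} (hq : GrMod.HasDegree (gr W) W.gr j q)
    (hq1 : ∀ x ∈ fil K 1, q x ∈ K) {n : ℕ} {x : Sym W} (hx : IsWord K n x) :
    ofTaylor W q x ∈ fil K (n + 1) := by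
  induction hx generalizing j q with
  | one =>
    rw [ofTaylor_one]
    exact ι_mem_fil_of_mem (hq _ _ SetLike.GradedOne.one_mem)
      (hq1 _ (IsWord.one.mem_fil zero_lt_one))
  | small hw hK hx ih =>
    rw [ofTaylor_ι_mul hq hw]
    exact add_mem (ih (hasDegree_comp_mulι hq hw)
        fun y hy => hq1 _ (ι_mul_mem_fil_of_mem hw hK hy))
      (Submodule.smul_mem _ _ (ι_mul_mem_fil_of_mem hw hK (ih hq hq1)))
  | big hw hx ih =>
    rw [ofTaylor_ι_mul hq hw]
    exact add_mem (ofTaylor_mem_fil (hasDegree_comp_mulι hq hw) hx)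
      (Submodule.smul_mem _ _ (ι_mul_mem_fil hw (ih hq hq1)))

/-- Every nonzero term consumes a letter outside `K`: if just one, the output is in `K`; if more, at
most one is returned. So the count drops. Feeding one outside letter to `q` leaves a coefficient
satisfying the hypothesis of `ofTaylor_mem_fil_succ`. -/
theorem ofTaylor_mem_fil_self {j : ℤ} {q : Sym W →ₗ[k] W} (hq : GrMod.HasDegree (gr W) W.gr j q)
    (hq1 : ∀ x ∈ fil K 1, q x = 0) (hq2 : ∀ x ∈ fil K 2, q x ∈ K) {n : ℕ} {x : Sym W}
    (hx : IsWord K n x) : ofTaylor W q x ∈ fil K n := by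
  induction hx generalizing j q with
  | one =>
    rw [ofTaylor_one, hq1 _ (IsWord.one.mem_fil zero_lt_one), map_zero]
    exact zero_mem _
  | small hw hK hx ih =>
    rw [ofTaylor_ι_mul hq hw]
    exact add_mem (ih (hasDegree_comp_mulι hq hw)
        (fun y hy => hq1 _ (ι_mul_mem_fil_of_mem hw hK hy))
        fun y hy => hq2 _ (ι_mul_mem_fil_of_mem hw hK hy))
      (Submodule.smul_mem _ _ (ι_mul_mem_fil_of_mem hw hK (ih hq hq1 hq2)))
  | big hw hx ih =>
    rw [ofTaylor_ι_mul hq hw]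
    exact add_mem (ofTaylor_mem_fil_succ (hasDegree_comp_mulι hq hw)
        (fun y hy => hq2 _ (ι_mul_mem_fil hw hy)) hx)
      (Submodule.smul_mem _ _ (ι_mul_mem_fil hw (ih hq hq1 hq2)))

end Sym

end

section

variable {k : Type v} [CommRing k]

namespace Sym

/-! ### Vector fields on a product -/

section Product

variable {B M : GrMod.{u} k}

theorem pr_extendLeft {j : ℤ} {Q : Sym B →ₗ[k] Sym B} (hQ : GrMod.HasDegree (gr B) (gr B) j Q)
    (x : Sym (B.prod M)) : pr (B.prod M) (extendLeft B M Q x) = (pr B (Q (projBase B M x)), 0) :=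
  pr_ofTaylor (((GrMod.hasDegree_inl B M).comp ((hasDegree_pr B).comp (hQ.comp
    (map_hasDegree _ (GrMod.hasDegree_fst B M)) (zero_add j)) (add_zero j)) (add_zero j))) x

theorem pr_extendRight {j : ℤ} {Q : Sym M →ₗ[k] Sym M} (hQ : GrMod.HasDegree (gr M) (gr M) j Q)
    (x : Sym (B.prod M)) :
    pr (B.prod M) (extendRight B M Q x) = (0, pr M (Q (projFibre B M x))) :=
  pr_ofTaylor (((GrMod.hasDegree_inr B M).comp ((hasDegree_pr M).comp (hQ.comp
    (map_hasDegree _ (GrMod.hasDegree_snd B M)) (zero_add j)) (add_zero j)) (add_zero j))) x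

theorem isVectorField_extendLeft {j : ℤ} {Q : Sym B →ₗ[k] Sym B}
    (hQ : GrMod.HasDegree (gr B) (gr B) j Q) : IsVectorField (B.prod M) j (extendLeft B M Q) :=
  isVectorField_ofTaylor (((GrMod.hasDegree_inl B M).comp ((hasDegree_pr B).comp (hQ.comp
    (map_hasDegree _ (GrMod.hasDegree_fst B M)) (zero_add j)) (add_zero j)) (add_zero j)))

variable (B M) in
theorem comul_projBase : comul B ∘ₗ (projBase B M).toLinearMap =
    TensorProduct.map (projBase B M).toLinearMap (projBase B M).toLinearMap ∘ₗ comul (B.prod M) :=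
  map_comul _ (GrMod.hasDegree_fst B M)

variable (B M) in
theorem comul_projFibre : comul M ∘ₗ (projFibre B M).toLinearMap =
    TensorProduct.map (projFibre B M).toLinearMap (projFibre B M).toLinearMap ∘ₗ comul (B.prod M) :=
  map_comul _ (GrMod.hasDegree_snd B M)

variable (B M) in
theorem comul_incl : comul (B.prod M) ∘ₗ (incl B M).toLinearMap =
    TensorProduct.map (incl B M).toLinearMap (incl B M).toLinearMap ∘ₗ comul M :=
  map_comul _ (GrMod.hasDegree_inr B M)

theorem pr_projBase (x : Sym (B.prod M)) : pr B (projBase B M x) = (pr (B.prod M) x).1 :=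
  pr_map _ _ x

theorem pr_projFibre (x : Sym (B.prod M)) : pr M (projFibre B M x) = (pr (B.prod M) x).2 :=
  pr_map _ _ x

theorem pr_incl (x : Sym M) : pr (B.prod M) (incl B M x) = (0, pr M x) :=
  pr_map _ _ x

theorem projBase_ι (w : B.prod M) : projBase B M (ι _ w) = ι B w.1 := map_ι _ _ w

theorem projFibre_incl (x : Sym M) : projFibre B M (incl B M x) = x := by
  have h : (projFibre B M).comp (incl B M) = AlgHom.id k _ := algHom_ext fun m =>
    (congrArg (projFibre B M) (map_ι _ _ m)).trans (map_ι _ _ _)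
  exact DFunLike.congr_fun h x

theorem projBase_incl (x : Sym M) : projBase B M (incl B M x) = counit M x • 1 := by
  have h : (projBase B M).comp (incl B M) = (Algebra.ofId k _).comp (counit M) :=
    algHom_ext fun m => by
      refine ((congrArg (projBase B M) (map_ι _ _ m)).trans (map_ι _ _ _)).trans ?_
      simp only [AlgHom.comp_apply, counit, lift_ι, LinearMap.zero_apply, map_zero]
      exact map_zero (ι B)
  rw [← Algebra.algebraMap_eq_smul_one]
  exact DFunLike.congr_fun h x

/-- The two projections determine both components of every Taylor coefficient. -/
theorem IsVectorField.eq_extendLeft_add_extendRight [Algebra ℚ k] {j : ℤ} {P : Sym B →ₗ[k] Sym B}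
    {Q : Sym M →ₗ[k] Sym M} {R : Sym (B.prod M) →ₗ[k] Sym (B.prod M)}
    (hR : IsVectorField (B.prod M) j R) (hP : ∀ x, projBase B M (R x) = P (projBase B M x))
    (hQ : ∀ x, projFibre B M (R x) = Q (projFibre B M x)) :
    R = extendLeft B M P + extendRight B M Q := by
  rw [hR.eq_ofTaylor, extendLeft, extendRight, ← ofTaylor_add]
  congr 1
  refine LinearMap.ext fun x => Prod.ext ?_ ?_
  · have h := pr_projBase (R x)
    rw [hP] at h
    exact h.symm.trans (add_zero _).symm
  · have h := pr_projFibre (R x)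
    rw [hQ] at h
    exact h.symm.trans (zero_add _).symm

/-! ### The filtration of `S(B × M)` by the number of factors in `B` -/

variable (B M) in
/-- The submodule `{0} × M` of `B × M`. -/
abbrev fibre : Submodule k (B.prod M) := LinearMap.ker (LinearMap.fst k B M)

theorem mem_fibre {w : B.prod M} : w ∈ fibre B M ↔ w.1 = 0 := Iff.rfl

theorem mem_range_incl_of_mem_fil {x : Sym (B.prod M)} (hx : x ∈ fil (fibre B M) 1) :
    ∃ m, incl B M m = x := by
  refine map_mem_of_mem_fil (S := LinearMap.range (incl B M).toLinearMap) LinearMap.id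
    (fun n hn y hy => ?_) hx
  induction hy with
  | one => exact ⟨1, map_one (incl B M)⟩
  | @small n x i w hw hK hx ih =>
    obtain ⟨m, hm⟩ := ih hn
    refine ⟨ι M w.2 * m, ?_⟩
    rw [LinearMap.id_apply, AlgHom.toLinearMap_apply] at hm ⊢
    rw [map_mul, hm]
    congr 1
    refine (map_ι _ _ _).trans (congrArg (ι _) ?_)
    exact Prod.ext (mem_fibre.1 hK).symm rfl
  | big hw hx ih => omega

theorem projBase_of_isWord_zero {n : ℕ} {x : Sym (B.prod M)} (hx : IsWord (fibre B M) n x)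
    (hn : n = 0) : projBase B M x = 0 ∨ projBase B M x = 1 := by
  cases hx with
  | one => exact Or.inr (map_one _)
  | small hw hK hx =>
    left
    rw [map_mul, projBase_ι, mem_fibre.1 hK, map_zero, zero_mul]
  | big hw hx => omega

/-- The projection to `B` kills letters of the fibre, so a word with at most one other letter
becomes 0, 1 or a single letter. -/
theorem map_projBase_eq_zero {Z : Type*} [AddCommGroup Z] [Module k Z] {φ : Sym B →ₗ[k] Z}
    (h1 : φ 1 = 0) (hι : ∀ b, φ (ι B b) = 0) {x : Sym (B.prod M)} (hx : x ∈ fil (fibre B M) 2) :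
    φ (projBase B M x) = 0 := by
  rw [← Submodule.mem_bot k]
  refine map_mem_of_mem_fil (φ ∘ₗ (projBase B M).toLinearMap) (fun n hn y hy => ?_) hx
  rw [Submodule.mem_bot, LinearMap.comp_apply, AlgHom.toLinearMap_apply]
  cases hy with
  | one => rw [map_one, h1]
  | small hw hK hx => rw [map_mul, projBase_ι, mem_fibre.1 hK, map_zero, zero_mul, map_zero]
  | big hw hx =>
    rw [map_mul, projBase_ι]
    rcases projBase_of_isWord_zero hx (by omega) with h | h
    · rw [h, mul_zero, map_zero]
    · rw [h, mul_one, hι]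

variable (B M) in
/-- The projection of `B × M` onto `B × {0}`. -/
def toBase : B.prod M →ₗ[k] B.prod M := LinearMap.inl k B M ∘ₗ LinearMap.fst k B M

theorem toBase_eq_zero {w : B.prod M} (hw : w ∈ fibre B M) : toBase B M w = 0 :=
  Prod.ext (mem_fibre.1 hw) rfl

theorem toBase_sub_mem (w : B.prod M) : toBase B M w - w ∈ fibre B M :=
  mem_fibre.2 (sub_self w.1)

theorem hasDegree_toBase : GrMod.HasDegree (B.prod M).gr (B.prod M).gr 0 (toBase B M) :=
  (GrMod.hasDegree_inl B M).comp (GrMod.hasDegree_fst B M) (add_zero 0)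

/-- This Euler field counts letters by their component in `B`. Replacing a letter by that component
changes it by an element of the fibre, which is an error of lower filtration. -/
theorem eulerBase_sub_mem_fil {n : ℕ} {x : Sym (B.prod M)} (hx : IsWord (fibre B M) n x) :
    ofTaylor (B.prod M) (toBase B M ∘ₗ pr (B.prod M)) x -
      (n : k) • x ∈ fil (fibre B M) n := by
  induction hx with
  | one =>
    rw [ofTaylor_one, LinearMap.comp_apply, pr_one, map_zero, map_zero, Nat.cast_zero, zero_smul,
      sub_zero]
    exact zero_mem _
  | @small n x i w hw hK hx ih =>
    rw [ofTaylor_comp_pr_ι_mul hasDegree_toBase hw, toBase_eq_zero hK, map_zero, zero_mul, zero_add, mul_zero,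
      sgn_zero, one_smul, ← mul_smul_comm, ← mul_sub]
    exact ι_mul_mem_fil_of_mem hw hK ih
  | @big n x i w hw hx ih =>
    have hw' := hasDegree_toBase i w hw
    rw [add_zero] at hw'
    have h1 : ι _ (toBase B M w) * x + ι _ w * ofTaylor (B.prod M)
        (toBase B M ∘ₗ pr (B.prod M)) x -
          ((n + 1 : ℕ) : k) • (ι _ w * x) = ι (B.prod M) (toBase B M w - w) * x +
        ι _ w * (ofTaylor (B.prod M)
          (toBase B M ∘ₗ pr (B.prod M)) x - (n : k) • x) := by
      rw [map_sub, sub_mul, mul_sub, Nat.cast_succ, add_smul, one_smul, mul_smul_comm]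
      abel
    rw [ofTaylor_comp_pr_ι_mul hasDegree_toBase hw, mul_zero, sgn_zero, one_smul, h1]
    exact add_mem (ι_mul_mem_fil_of_mem (sub_mem hw' hw) (toBase_sub_mem w) (hx.mem_fil n.lt_succ_self))
      (ι_mul_mem_fil hw ih)

/-- Subtract the Euler field of `B`. The remaining coefficient vanishes on words in `M`. On words
with at most one letter outside `M` its component in `B` vanishes, since `P` has no constant term
and identity linear part. By `ofTaylor_mem_fil_self` it lowers the filtration. -/
theorem IsVectorField.isTriangular [Algebra ℚ k] {E : Sym (B.prod M) →ₗ[k] Sym (B.prod M)}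
    {P : Sym B →ₗ[k] Sym B} (hE : IsVectorField (B.prod M) 0 E)
    (hP : ∀ x, projBase B M (E x) = P (projBase B M x)) (hP1 : pr B (P 1) = 0)
    (hPι : ∀ b, pr B (P (ι B b)) = b) (hE1 : ∀ x, pr (B.prod M) (E (incl B M x)) = 0) :
    IsTriangular (fil (fibre B M)) E := by
  refine isTriangular_fil fun n x hx => ?_
  set r := toBase B M ∘ₗ pr (B.prod M) with hr
  have hrd : GrMod.HasDegree (gr (B.prod M)) (B.prod M).gr 0 r :=
    hasDegree_toBase.comp (hasDegree_pr _) (add_zero 0)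
  have hqd : GrMod.HasDegree (gr (B.prod M)) (B.prod M).gr 0 (pr (B.prod M) ∘ₗ E - r) :=
    ((hasDegree_pr _).comp hE.degree (add_zero 0)).sub hrd
  have h1 : E x - (n : k) • x = ofTaylor _ (pr (B.prod M) ∘ₗ E - r) x +
      (ofTaylor _ r x - (n : k) • x) := by
    rw [← add_sub_assoc, ← LinearMap.add_apply, ← ofTaylor_add, sub_add_cancel,
      ← hE.eq_ofTaylor]
  rw [h1]
  refine add_mem (ofTaylor_mem_fil_self hqd (fun y hy => ?_) (fun y hy => ?_) hx)
    (eulerBase_sub_mem_fil hx)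
  · obtain ⟨m, rfl⟩ := mem_range_incl_of_mem_fil hy
    rw [LinearMap.sub_apply, LinearMap.comp_apply, hE1, hr, LinearMap.comp_apply,
      toBase_eq_zero (mem_fibre.2 (congrArg Prod.fst (pr_incl m))), sub_zero]
  · have h2 := map_projBase_eq_zero (φ := pr B ∘ₗ P - pr B) (by simp [hP1]) (by simp [hPι]) hy
    rw [LinearMap.sub_apply, LinearMap.comp_apply, ← hP, pr_projBase, pr_projBase] at h2
    exact h2

end Product

end Sym

open FormalDG.Sym

/-! ### Transport of vector fields along automorphisms -/

section Transport

variable {W : GrMod.{u} k} {F : Sym W ≃ₗ[k] Sym W}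

theorem hasDegree_symm (hF : GrMod.HasDegree (gr W) (gr W) 0 F.toLinearMap) :
    GrMod.HasDegree (gr W) (gr W) 0 F.symm.toLinearMap := by
  intro d x hx
  have h := hF.decompose_apply d (F.symm x)
  simp only [LinearEquiv.coe_coe, LinearEquiv.apply_symm_apply] at h
  rw [DirectSum.decompose_of_mem_same _ hx] at h
  rw [add_zero, LinearEquiv.coe_coe, F.symm_apply_eq.2 h]
  exact Subtype.property _

theorem comul_symm (hF : comul W ∘ₗ F.toLinearMap =
      TensorProduct.map F.toLinearMap F.toLinearMap ∘ₗ comul W) :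
    comul W ∘ₗ F.symm.toLinearMap =
      TensorProduct.map F.symm.toLinearMap F.symm.toLinearMap ∘ₗ comul W := by
  have h1 : F.toLinearMap ∘ₗ F.symm.toLinearMap = LinearMap.id :=
    LinearMap.ext F.apply_symm_apply
  have h2 : F.symm.toLinearMap ∘ₗ F.toLinearMap = LinearMap.id :=
    LinearMap.ext F.symm_apply_apply
  calc comul W ∘ₗ F.symm.toLinearMap
      = TensorProduct.map (F.symm.toLinearMap ∘ₗ F.toLinearMap)
          (F.symm.toLinearMap ∘ₗ F.toLinearMap) ∘ₗ comul W ∘ₗ F.symm.toLinearMap := by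
        rw [h2, TensorProduct.map_id, LinearMap.id_comp]
    _ = TensorProduct.map F.symm.toLinearMap F.symm.toLinearMap ∘ₗ
          (comul W ∘ₗ F.toLinearMap) ∘ₗ F.symm.toLinearMap := by
        rw [TensorProduct.map_comp, hF]
        rfl
    _ = TensorProduct.map F.symm.toLinearMap F.symm.toLinearMap ∘ₗ comul W := by
        rw [LinearMap.comp_assoc, h1, LinearMap.comp_id]

theorem Sym.IsDGStructure.conj {Q : Sym W →ₗ[k] Sym W} (hQ : IsDGStructure W Q)
    (hd : GrMod.HasDegree (gr W) (gr W) 0 F.toLinearMap)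
    (hF : comul W ∘ₗ F.toLinearMap =
      TensorProduct.map F.toLinearMap F.toLinearMap ∘ₗ comul W) :
    IsDGStructure W (F.toLinearMap ∘ₗ Q ∘ₗ F.symm.toLinearMap) where
  degree := hd.comp (hQ.degree.comp (hasDegree_symm hd) (zero_add 1)) (add_zero 1)
  coderivation := by
    have h1 : F.toLinearMap ∘ₗ F.symm.toLinearMap = LinearMap.id :=
      LinearMap.ext F.apply_symm_apply
    have h2 := (hQ.toIsVectorField.map_comp hF hd)
    unfold IsCoderivationAlong at h2
    rw [← LinearMap.comp_assoc, ← LinearMap.comp_assoc, LinearMap.comp_assoc _ F.toLinearMap,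
      h2, LinearMap.comp_assoc, comul_symm hF, ← LinearMap.comp_assoc, LinearMap.add_comp,
      ← TensorProduct.map_comp, ← TensorProduct.map_comp, LinearMap.comp_assoc _ F.toLinearMap, h1,
      LinearMap.comp_assoc, LinearMap.comp_id]
  sq_zero := LinearMap.ext fun x => by
    have h := LinearMap.congr_fun hQ.sq_zero (F.symm x)
    simp only [LinearMap.comp_apply, LinearEquiv.coe_coe, LinearEquiv.symm_apply_apply] at h ⊢
    rw [h]
    simp

end Transport

/-- An intertwiner of two vector fields of degree zero has degree zero. -/
theorem hasDegree_intertwiner [Algebra ℚ k] {W : GrMod.{u} k} {Fil : ℕ → Submodule k (Sym W)}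
    {E E₀ F : Module.End k (Sym W)} (h : IsTriangular Fil E) (h₀ : IsTriangular Fil E₀)
    (hF : ∀ n, ∀ x ∈ eig E n, F x ∈ eig E₀ n ∧ F x - x ∈ Fil n)
    (hE : GrMod.HasDegree (gr W) (gr W) 0 E) (hE₀ : GrMod.HasDegree (gr W) (gr W) 0 E₀) :
    GrMod.HasDegree (gr W) (gr W) 0 F := by
  intro d x hx
  -- The projection to degree `d` commutes with `E` and `E₀`, hence with `F`.
  let p : Sym W →ₗ[k] Sym W := (gr W d).subtype ∘ₗ DirectSum.component k ℤ _ d ∘ₗ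
    (DirectSum.decomposeLinearEquiv (gr W)).toLinearMap
  have hp : ∀ y, p y = (DirectSum.decompose (gr W) y d : Sym W) := fun y => rfl
  have hc := LinearMap.congr_fun (IsTriangular.intertwiner_comm h h₀ hF (f := p)
    (LinearMap.ext fun y => hE.decompose_apply d y)
    (LinearMap.ext fun y => hE₀.decompose_apply d y)) x
  simp only [LinearMap.comp_apply, hp, DirectSum.decompose_of_mem_same _ hx] at hc
  rw [← hc, add_zero]
  exact Subtype.property _

end

section

variable {k : Type v} [CommRing k]

open FormalDG.Sym

/-! ### The linear vector field of a contraction -/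

section Contraction

variable {W : GrMod.{u} k} {h : W →ₗ[k] W}

theorem hasDegree_comp_pr (hh : GrMod.HasDegree W.gr W.gr (-1) h) :
    GrMod.HasDegree (gr W) W.gr (-1) (h ∘ₗ pr W) :=
  hh.comp (hasDegree_pr W) (zero_add _)

variable {Q : Sym W →ₗ[k] Sym W}

/-- The commutator of `Q` and the linear vector field `h`. -/
def contractionField (Q : Sym W →ₗ[k] Sym W) (h : W →ₗ[k] W) : Sym W →ₗ[k] Sym W :=
  Q ∘ₗ ofTaylor W (h ∘ₗ pr W) + ofTaylor W (h ∘ₗ pr W) ∘ₗ Q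

theorem isVectorField_contractionField (hQ : IsVectorField W 1 Q)
    (hh : GrMod.HasDegree W.gr W.gr (-1) h) : IsVectorField W 0 (contractionField Q h) :=
  isVectorField_anticommutator hQ (isVectorField_ofTaylor (hasDegree_comp_pr hh))

/-- Since `Q² = 0`, both sides reduce to `Q H Q`. -/
theorem comp_contractionField (hQ : Q ∘ₗ Q = 0) :
    Q ∘ₗ contractionField Q h = contractionField Q h ∘ₗ Q := by
  have hQ' : ∀ x, Q (Q x) = 0 := LinearMap.congr_fun hQ
  exact LinearMap.ext fun x => by simp [contractionField, hQ']

theorem pr_contractionField_ι (hh : GrMod.HasDegree W.gr W.gr (-1) h)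
    (hQh : linPart Q ∘ₗ h + h ∘ₗ linPart Q = LinearMap.id) (w : W) :
    pr W (contractionField Q h (ι W w)) = w := by
  have h1 : ofTaylor W (h ∘ₗ pr W) (ι W w) = ι W (h w) := by
    simp [ofTaylor, comul_ι]
  have h2 := LinearMap.congr_fun hQh w
  rw [contractionField, LinearMap.add_apply, LinearMap.comp_apply, LinearMap.comp_apply, h1, map_add,
    pr_ofTaylor (hasDegree_comp_pr hh)]
  exact h2

variable [Algebra ℚ k]

theorem apply_one_eq_zero {j : ℤ} {Q : Sym W →ₗ[k] Sym W} (hQ : IsVectorField W j Q)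
    (h0 : pr W (Q 1) = 0) : Q 1 = 0 := by
  have h1 := LinearMap.congr_fun hQ.coderivation 1
  rw [LinearMap.comp_apply, LinearMap.comp_apply, comul_one, LinearMap.add_apply,
    TensorProduct.map_tmul, TensorProduct.map_tmul, koszul_one] at h1
  rw [eq_ι_pr_of_primitive h1, h0, map_zero]

theorem contractionField_one (hQ : IsVectorField W 1 Q) (h0 : constPart Q = 0) :
    contractionField Q h 1 = 0 := by
  have h1 : Q 1 = 0 := apply_one_eq_zero hQ h0
  simp [contractionField, h1, ofTaylor_one]

end Contraction

/-! ### Contraction of a deformation -/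

namespace Deformation

variable {M B : DGManifold.{u} k}

variable (M) in
/-- The extension to `B × M` of a linear map of `B`. -/
def extendLinear (h : B.toGrMod →ₗ[k] B.toGrMod) :
    B.toGrMod.prod M.toGrMod →ₗ[k] B.toGrMod.prod M.toGrMod :=
  LinearMap.inl k B.toGrMod M.toGrMod ∘ₗ h ∘ₗ LinearMap.fst k B.toGrMod M.toGrMod

variable {h : B.toGrMod →ₗ[k] B.toGrMod}

theorem hasDegree_extendLinear (hh : GrMod.HasDegree B.toGrMod.gr B.toGrMod.gr (-1) h) :
    GrMod.HasDegree (B.toGrMod.prod M.toGrMod).gr (B.toGrMod.prod M.toGrMod).gr (-1)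
      (extendLinear M h) :=
  (GrMod.hasDegree_inl _ _).comp (hh.comp (GrMod.hasDegree_fst _ _) (zero_add _)) (add_zero _)

theorem projBase_totalField (D : Deformation M B) (x : Sym (B.toGrMod.prod M.toGrMod)) :
    projBase B.toGrMod M.toGrMod (totalField M B D.Q x) =
      B.Q (projBase B.toGrMod M.toGrMod x) :=
  LinearMap.congr_fun D.proj_equivariant x

variable [Algebra ℚ k]

/-- On words in `M` the field `Q` vanishes, and `Q^B` contributes only its constant coefficient,
which is 0 because `B` is local. -/
theorem totalField_incl (D : Deformation M B) (x : Sym M.toGrMod) :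
    totalField M B D.Q (incl B.toGrMod M.toGrMod x) = incl B.toGrMod M.toGrMod (M.Q x) := by
  have hc := comul_incl B.toGrMod M.toGrMod
  have h : totalField M B D.Q ∘ₗ (incl B.toGrMod M.toGrMod).toLinearMap =
      (incl B.toGrMod M.toGrMod).toLinearMap ∘ₗ M.Q := by
    refine (D.isDG.toIsVectorField.comp_map hc).ext (M.isDG.toIsVectorField.map_comp hc
      (map_hasDegree _ _)) (map_one (incl B.toGrMod M.toGrMod)) fun y => ?_
    have h1 : D.Q (incl B.toGrMod M.toGrMod y) = 0 := LinearMap.congr_fun D.restrict_eq_zero y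
    have h2 : pr B.toGrMod (B.Q 1) = 0 := D.isLocal_base
    change pr _ (totalField M B D.Q (incl _ _ y)) = pr _ (incl _ _ (M.Q y))
    rw [totalField, LinearMap.add_apply, LinearMap.add_apply, h1, add_zero, map_add,
      pr_extendLeft B.isDG.degree, pr_extendRight M.isDG.degree, pr_incl, projBase_incl,
      projFibre_incl, _root_.map_smul, _root_.map_smul, h2, smul_zero]
    exact zero_add (((0, pr M.toGrMod (M.Q y)) : B.toGrMod × M.toGrMod))
  exact LinearMap.congr_fun h x

theorem projBase_linearField (hh : GrMod.HasDegree B.toGrMod.gr B.toGrMod.gr (-1) h)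
    (x : Sym (B.toGrMod.prod M.toGrMod)) :
    projBase B.toGrMod M.toGrMod (ofTaylor _ (extendLinear M h ∘ₗ pr _) x) =
      ofTaylor _ (h ∘ₗ pr _) (projBase B.toGrMod M.toGrMod x) := by
  have hc := comul_projBase B.toGrMod M.toGrMod
  have hH := hasDegree_comp_pr (hasDegree_extendLinear (M := M) hh)
  have h1 : (projBase B.toGrMod M.toGrMod).toLinearMap ∘ₗ
      ofTaylor _ (extendLinear M h ∘ₗ pr _) =
      ofTaylor _ (h ∘ₗ pr _) ∘ₗ (projBase B.toGrMod M.toGrMod).toLinearMap := by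
    refine ((isVectorField_ofTaylor hH).map_comp hc (map_hasDegree _ _)).ext
      ((isVectorField_ofTaylor (hasDegree_comp_pr hh)).comp_map hc)
      (map_one (projBase B.toGrMod M.toGrMod)) fun y => ?_
    change pr _ (projBase _ _ (ofTaylor _ _ y)) = pr _ (ofTaylor _ _ (projBase _ _ y))
    rw [pr_projBase, pr_ofTaylor hH, pr_ofTaylor (hasDegree_comp_pr hh), LinearMap.comp_apply,
      LinearMap.comp_apply, pr_projBase]
    rfl
  exact LinearMap.congr_fun h1 x

theorem linearField_incl (hh : GrMod.HasDegree B.toGrMod.gr B.toGrMod.gr (-1) h)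
    (x : Sym M.toGrMod) :
    ofTaylor _ (extendLinear M h ∘ₗ pr _) (incl B.toGrMod M.toGrMod x) = 0 := by
  have hc := comul_incl B.toGrMod M.toGrMod
  have hH := hasDegree_comp_pr (hasDegree_extendLinear (M := M) hh)
  have h1 : ofTaylor _ (extendLinear M h ∘ₗ pr _) ∘ₗ
      (incl B.toGrMod M.toGrMod).toLinearMap = 0 := by
    refine ((isVectorField_ofTaylor hH).comp_map hc).eq_zero
      (map_one (incl B.toGrMod M.toGrMod)) fun y => ?_
    change pr _ (ofTaylor _ _ (incl _ _ y)) = 0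
    rw [pr_ofTaylor hH, LinearMap.comp_apply]
    have h2 : (pr _ (incl B.toGrMod M.toGrMod y)).1 = 0 := congrArg Prod.fst (pr_incl y)
    refine (congrArg (fun b => LinearMap.inl k B.toGrMod M.toGrMod (h b)) h2).trans ?_
    rw [map_zero, map_zero]
    rfl
  exact LinearMap.congr_fun h1 x

variable (D : Deformation M B)

theorem projBase_contractionField (hh : GrMod.HasDegree B.toGrMod.gr B.toGrMod.gr (-1) h)
    (x : Sym (B.toGrMod.prod M.toGrMod)) :
    projBase B.toGrMod M.toGrMod (contractionField (totalField M B D.Q) (extendLinear M h) x) =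
      contractionField B.Q h (projBase B.toGrMod M.toGrMod x) := by
  simp only [contractionField, LinearMap.add_apply, LinearMap.comp_apply, map_add,
    projBase_totalField, projBase_linearField hh]

theorem contractionField_incl (hh : GrMod.HasDegree B.toGrMod.gr B.toGrMod.gr (-1) h)
    (x : Sym M.toGrMod) : contractionField (totalField M B D.Q) (extendLinear M h)
      (incl B.toGrMod M.toGrMod x) = 0 := by
  simp only [contractionField, LinearMap.add_apply, LinearMap.comp_apply, totalField_incl,
    linearField_incl hh, map_zero, add_zero]

theorem isTriangular_contractionField
    (hh : GrMod.HasDegree B.toGrMod.gr B.toGrMod.gr (-1) h)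
    (hQh : linPart B.Q ∘ₗ h + h ∘ₗ linPart B.Q = LinearMap.id) :
    IsTriangular (fil (fibre B.toGrMod M.toGrMod))
      (contractionField (totalField M B D.Q) (extendLinear M h)) :=
  (isVectorField_contractionField D.isDG.toIsVectorField (hasDegree_extendLinear hh)).isTriangular
    (D.projBase_contractionField hh)
    (by rw [contractionField_one B.isDG.toIsVectorField D.isLocal_base, map_zero])
    (pr_contractionField_ι hh hQh)
    fun x => by rw [D.contractionField_incl hh, map_zero]

end Deformation

/-! ### The model field: a field of the base acting on the product -/

section ExtendLeft

variable [Algebra ℚ k] {B M : GrMod.{u} k} {P : Sym B →ₗ[k] Sym B}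

theorem projBase_extendLeft {j : ℤ} (hP : IsVectorField B j P) (x : Sym (B.prod M)) :
    projBase B M (extendLeft B M P x) = P (projBase B M x) := by
  have hc := comul_projBase B M
  have h : (projBase B M).toLinearMap ∘ₗ extendLeft B M P =
      P ∘ₗ (projBase B M).toLinearMap := by
    refine ((isVectorField_extendLeft hP.degree).map_comp hc (map_hasDegree _ _)).ext
      (hP.comp_map hc) (map_one (projBase B M)) fun y => ?_
    change pr _ (projBase _ _ (extendLeft _ _ _ y)) = pr _ (P (projBase _ _ y))
    rw [pr_projBase, pr_extendLeft hP.degree]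
  exact LinearMap.congr_fun h x

theorem projFibre_extendLeft {j : ℤ} (hP : IsVectorField B j P) (x : Sym (B.prod M)) :
    projFibre B M (extendLeft B M P x) = 0 := by
  have hc := comul_projFibre B M
  have h : (projFibre B M).toLinearMap ∘ₗ extendLeft B M P = 0 := by
    refine ((isVectorField_extendLeft hP.degree).map_comp hc (map_hasDegree _ _)).eq_zero
      (map_one (projFibre B M)) fun y => ?_
    change pr _ (projFibre _ _ (extendLeft _ _ _ y)) = 0
    rw [pr_projFibre, pr_extendLeft hP.degree]
  exact LinearMap.congr_fun h x

theorem isTriangular_extendLeft (hP : IsVectorField B 0 P) (hP1 : P 1 = 0)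
    (hPι : ∀ b, pr B (P (ι B b)) = b) :
    IsTriangular (fil (fibre B M)) (extendLeft B M P) :=
  (isVectorField_extendLeft hP.degree).isTriangular (projBase_extendLeft hP)
    (by rw [hP1, map_zero]) hPι fun x => by
      rw [pr_extendLeft hP.degree, projBase_incl, _root_.map_smul, hP1, smul_zero, map_zero]
      rfl

end ExtendLeft

/-! ### The trivialization -/

namespace Deformation

variable [Algebra ℚ k] {M B : DGManifold.{u} k}

/-- A deformation whose base is contractible becomes a product after an automorphism of the
coalgebra `S(B × M)` over `B` and under `M`. -/
theorem exists_trivialization (D : Deformation M B) (hB : B.IsContractible) :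
    ∃ F : Sym (B.toGrMod.prod M.toGrMod) ≃ₗ[k] Sym (B.toGrMod.prod M.toGrMod),
      GrMod.HasDegree (gr _) (gr _) 0 F.toLinearMap ∧
      comul _ ∘ₗ F.toLinearMap = TensorProduct.map F.toLinearMap F.toLinearMap ∘ₗ comul _ ∧
      (∀ x, projBase B.toGrMod M.toGrMod (F x) = projBase B.toGrMod M.toGrMod x) ∧
      (∀ x, F (incl B.toGrMod M.toGrMod x) = incl B.toGrMod M.toGrMod x) ∧
      ∀ x, projFibre B.toGrMod M.toGrMod (F (totalField M B D.Q x)) =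
        M.Q (projFibre B.toGrMod M.toGrMod (F x)) := by
  obtain ⟨h, hh, hQh⟩ := hB
  have hEB := isVectorField_contractionField B.isDG.toIsVectorField hh
  have hE := isVectorField_contractionField D.isDG.toIsVectorField (hasDegree_extendLinear hh)
  have tE := D.isTriangular_contractionField hh hQh
  have hE₀ := isVectorField_extendLeft (M := M.toGrMod) hEB.degree
  have tE₀ := isTriangular_extendLeft (M := M.toGrMod) hEB
    (contractionField_one B.isDG.toIsVectorField D.isLocal_base) (pr_contractionField_ι hh hQh)
  have hEQ := comp_contractionField (h := extendLinear M h) D.isDG.sq_zero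
  have hEi := D.contractionField_incl hh
  have hEb := D.projBase_contractionField hh
  generalize contractionField (totalField M B D.Q) (extendLinear M h) = E at *
  have hE₀b := projBase_extendLeft (M := M.toGrMod) hEB
  have hE₀f := projFibre_extendLeft (M := M.toGrMod) hEB
  generalize extendLeft B.toGrMod M.toGrMod (contractionField B.Q h) = E₀ at *
  obtain ⟨F, hF⟩ := tE.exists_intertwiner tE₀
  -- `E` kills `S(M)`, and on the 0-eigenspace `F - 1` takes values in `Fil 0 = 0`.
  have hFi : ∀ x, F (incl B.toGrMod M.toGrMod x) = incl B.toGrMod M.toGrMod x := fun x => by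
    have h0 := (hF 0 (incl B.toGrMod M.toGrMod x) (by rw [mem_eig, hEi]; simp)).2
    rw [fil_zero, Submodule.mem_bot] at h0
    exact sub_eq_zero.1 h0
  -- `E₀` moves only the base, so applying the projection to `M` to `E₀ (F x) = n F x` gives `0` on
  -- the left, and `n` is a unit.
  have hFn : ∀ n : ℕ, n ≠ 0 → ∀ x ∈ eig E n, projFibre B.toGrMod M.toGrMod (F x) = 0 := by
    intro n hn x hx
    have h1 := congrArg (projFibre B.toGrMod M.toGrMod) (mem_eig.1 (hF n x hx).1)
    rw [hE₀f, _root_.map_smul] at h1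
    have h2 := isUnit_natCast_sub k hn
    rw [Nat.cast_zero, sub_zero] at h2
    exact h2.smul_eq_zero.1 h1.symm
  refine ⟨LinearEquiv.ofBijective F (tE.intertwiner_bijective hF),
    hasDegree_intertwiner tE tE₀ hF hE.degree hE₀.degree,
    tE.intertwiner_map_comul tE₀ hF (comul_comp_of_isVectorField_zero hE)
      (comul_comp_of_isVectorField_zero hE₀),
    LinearMap.congr_fun (tE.comp_intertwiner tE₀ hF
      (f := (projBase B.toGrMod M.toGrMod).toLinearMap) (T := contractionField B.Q h)
      (LinearMap.ext hEb) (LinearMap.ext hE₀b)), hFi, ?_⟩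
  refine LinearMap.congr_fun (tE.hom_ext
    (f := (projFibre B.toGrMod M.toGrMod).toLinearMap ∘ₗ F ∘ₗ totalField M B D.Q)
    (g := M.Q ∘ₗ (projFibre B.toGrMod M.toGrMod).toLinearMap ∘ₗ F) fun n x hx => ?_)
  change projFibre B.toGrMod M.toGrMod (F (totalField M B D.Q x)) =
        M.Q (projFibre B.toGrMod M.toGrMod (F x))
  -- The 0-eigenspace lies in `Fil 1`, the image of `S(M)`. For `n ≠ 0` both sides vanish, since
  -- `Q̃` commutes with `E` and so preserves its eigenspaces.
  rcases eq_or_ne n 0 with rfl | hn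
  · obtain ⟨m, rfl⟩ := mem_range_incl_of_mem_fil (tE.eig_le 0 hx)
    rw [totalField_incl, hFi, hFi, projFibre_incl, projFibre_incl]
  · rw [hFn n hn x hx, hFn n hn _ (map_mem_eig hEQ hx), map_zero]

/-- A deformation whose base is contractible is isomorphic over its base to the one with `Q = 0`. -/
theorem exists_trivial_iso (D : Deformation M B) (hB : B.IsContractible) :
    ∃ T : Deformation M B, T.Q = 0 ∧ T.IsTrivial ∧ ∃ e : Iso D T, e.hom.f = 𝟙 B := by
  obtain ⟨F, hFd, hFc, hFb, hFi, hFf⟩ := D.exists_trivialization hB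
  have hdg := D.isDG.conj hFd hFc
  have hFb' : ∀ x, projBase B.toGrMod M.toGrMod (F.symm x) = projBase B.toGrMod M.toGrMod x :=
    fun x => by rw [← hFb, F.apply_symm_apply]
  have hbase : ∀ x, projBase B.toGrMod M.toGrMod
      ((F.toLinearMap ∘ₗ totalField M B D.Q ∘ₗ F.symm.toLinearMap) x) =
        B.Q (projBase B.toGrMod M.toGrMod x) := fun x => by
    rw [LinearMap.comp_apply, LinearMap.comp_apply, LinearEquiv.coe_coe, LinearEquiv.coe_coe, hFb,
      projBase_totalField, hFb']
  have hfibre : ∀ x, projFibre B.toGrMod M.toGrMod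
      ((F.toLinearMap ∘ₗ totalField M B D.Q ∘ₗ F.symm.toLinearMap) x) =
        M.Q (projFibre B.toGrMod M.toGrMod x) := fun x => by
    rw [LinearMap.comp_apply, LinearMap.comp_apply, LinearEquiv.coe_coe, LinearEquiv.coe_coe, hFf,
      F.apply_symm_apply]
  have htot : F.toLinearMap ∘ₗ totalField M B D.Q ∘ₗ F.symm.toLinearMap = totalField M B 0 := by
    rw [show totalField M B 0 = extendLeft _ _ B.Q + extendRight _ _ M.Q from add_zero _]
    exact hdg.toIsVectorField.eq_extendLeft_add_extendRight hbase hfibre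
  have hcomm : ∀ x, F (totalField M B D.Q x) = totalField M B 0 (F x) := fun x => by
    rw [← htot, LinearMap.comp_apply, LinearMap.comp_apply, LinearEquiv.coe_coe,
      LinearEquiv.coe_coe, F.symm_apply_apply]
  -- The conjugate of `Q̃` is `Q^B + Q^M`; so that sum is a DG structure with both projections
  -- equivariant, by transport from `Q̃`.
  rw [htot] at hdg hbase hfibre
  have hF1 : F 1 = 1 := by
    have h1 := hFi 1
    rwa [map_one (incl B.toGrMod M.toGrMod)] at h1
  let T : Deformation M B :=
    { isLocal_base := D.isLocal_base
      Q := 0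
      isVectorField :=
        { degree := fun i x _ => zero_mem _
          coderivation := by simp }
      constPart_eq_zero := by simp [constPart]
      restrict_eq_zero := LinearMap.zero_comp _
      isDG := hdg
      proj_equivariant := LinearMap.ext hbase }
  let f : D.total ⟶ T.total :=
    ({ toLin := F.toLinearMap
       degree := hFd
       map_one := hF1
       comul := hFc
       equivariant := LinearMap.ext hcomm } : DGManifold.Hom D.total T.total)
  let g : T.total ⟶ D.total :=
    ({ toLin := F.symm.toLinearMap
       degree := hasDegree_symm hFd
       map_one := F.symm_apply_eq.2 hF1.symm
       comul := comul_symm hFc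
       equivariant := LinearMap.ext fun x => F.symm_apply_eq.2
         (LinearMap.congr_fun htot x).symm } : DGManifold.Hom T.total D.total)
  have hfg : f ≫ g = 𝟙 D.total := DGManifold.Hom.ext (LinearMap.ext F.symm_apply_apply)
  have hgf : g ≫ f = 𝟙 T.total := DGManifold.Hom.ext (LinearMap.ext F.apply_symm_apply)
  have hf : IsIso f := ⟨g, hfg, hgf⟩
  have hg : IsIso g := ⟨f, hgf, hfg⟩
  refine ⟨T, rfl, LinearMap.ext hfibre, ⟨⟨f, 𝟙 B, ?_, LinearMap.ext hFi⟩, ⟨g, 𝟙 B, ?_, ?_⟩, hfg,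
    Category.comp_id _, hgf, Category.comp_id _⟩, rfl⟩
  -- A commutative square whose horizontal sides are isomorphisms is cartesian.
  · exact IsPullback.of_horiz_isIso ⟨DGManifold.Hom.ext (LinearMap.ext hFb)⟩
  · exact IsPullback.of_horiz_isIso ⟨DGManifold.Hom.ext (LinearMap.ext hFb')⟩
  · exact LinearMap.ext fun x => F.symm_apply_eq.2 (hFi x).symm

end Deformation

end

end FormalDG

end

theorem mainTheorem9 {k : Type v} [CommRing k] [Algebra ℚ k]
    (M B : FormalDG.DGManifold.{u} k) (D : FormalDG.Deformation M B)
    (hB : B.IsContractible) (hQ : FormalDG.Sym.linPart D.Q = 0) :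
    ∃ T : FormalDG.Deformation M B, T.Q = 0 ∧ T.IsTrivial ∧
      ∃ e : FormalDG.Deformation.Iso D T, e.hom.f = 𝟙 B :=
  D.exists_trivial_iso hB
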